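/- Conventions. A permutation of length $n$ is a bijection of $[n]=\{1,\dots,n\}$. $\sigma$ is a subpermutation of $\pi$ if some subsequence of $\pi$ has the same order type as $\sigma$. A permutation property $\mathcal P$ is a family of permutations; it is hereditary if every subpermutation of a member is a member. Blow-up parameter. A $k$-blow-up of a permutation $\alpha$ of length $m$ is a permutation $\alpha'$ of length $km$ such that, when $[km]$ is cut into $m$ consecutive blocks of size $k$ and $i_1,i_2$ lie in different blocks, numbered $j_1\ne j_2$, one has $\alpha'(i_1)>\alpha'(i_2)$ if and only if $\alpha(j_1)>\alpha(j_2)$. Let $k^*(\alpha)$ be the least $k\ge 1$ such that no $k$-blow-up of $\alpha$ lies in $\mathcal P$ ($\infty$ if there is none). Let $k^*(T)$ be the maximum of $k^*(\alpha)$ over all $\alpha$ of length $T$ with $k^*(\alpha)<\infty$ ($\infty$ if there is no such $\alpha$). Distances. For $\pi_1,\pi_2$ of length $n$, the planar tau distance is $\binom n2^{-1}$ times the least number of planar simple transpositions (exchanging the entries in two adjacent positions, or exchanging two adjacent values) that transform $\pi_1$ into $\pi_2$. The earth mover's distance is $$\rho_{\mathrm{EMD}}(\pi_1,\pi_2)=\binom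 n2^{-1}\min_{\theta}\sum_{i=1}^n\bigl(|i-\theta(i)|+|\pi_1(i)-\pi_2(\theta(i))|\bigr),$$ the minimum being over all bijections $\theta:[n]\to[n]$. (For $n\le 1$ both distances are $0$.) The distance of $\pi$ from $\mathcal P$ is the minimum distance from $\pi$ to a member of $\mathcal P$ of the same length, and $1$ if there is no such member; $\pi$ is $\epsilon$-far from $\mathcal P$ if this distance is at least $\epsilon$. **Theorem 5.** Let $\mathcal P$ be a hereditary permutation property and $\epsilon>0$. Put $M=\lceil 20000/\epsilon^2\rceil$ and $n_0=32M^5k^*(M)/\epsilon^3$. Then there is a two-sided tester for $\mathcal P$, with respect to the planar tau distance and also with respect to the earth mover's distance, that makes $M$ queries and works for all permutations of length at least $n_0$. Precisely, there is a set $A$ of permutations of length $M$, depending only on $\mathcal P$ and $\epsilon$, such that the following holds for every $n\ge M$ for which $n\ge n_0$ or $k^*(M)=\infty$, and for every permutation $\pi$ of length $n$. Let $\pi'$ be the subpermutation of $\pi$ induced on a uniformly random $M$-element subset of $[n]$. 1. If $\pi\in\mathcal P$, then $\pi'\in A$ with probability at least $\max(2/3,\,1-\epsilon)$. 2. If $\pi$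 is $\epsilon$-far from $\mathcal P$ with respect to the planar tau distance or with respect to the earth mover's distance, then $\pi'\notin A$ with probability at least $\max(2/3,\,1-\epsilon)$. -/

import Mathlib

open scoped ENNReal

namespace PermTesting

noncomputable section

/-- A permutation property: a family of permutations, sorted by length. A permutation of length `n`
is a bijection of `Fin n` (positions and values are numbered from `0`). -/
abbrev PermProperty : Type := (n : ℕ) → Set (Equiv.Perm (Fin n))

/-- `σ` is a subpermutation of `π`: some subsequence of `π` has the order type of `σ`. -/
def IsSubperm {k n : ℕ} (σ : Equiv.Perm (Fin k)) (π : Equiv.Perm (Fin n)) : Prop :=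
  ∃ f : Fin k ↪o Fin n, ∀ j l : Fin k, π (f j) < π (f l) ↔ σ j < σ l

/-- A property is hereditary if it is closed under taking subpermutations. -/
def Hereditary (P : PermProperty) : Prop :=
  ∀ (k n : ℕ) (σ : Equiv.Perm (Fin k)) (π : Equiv.Perm (Fin n)),
    π ∈ P n → IsSubperm σ π → σ ∈ P k

/-! ### Blow-ups -/

/-- `β` is a blow-up of `α` whose `j`-th block is the set of positions `i` with
`b j ≤ i < b (j + 1)`; all blocks are nonempty. -/
def IsBlowUpWith {m n : ℕ} (α : Equiv.Perm (Fin m)) (β : Equiv.Perm (Fin n))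
    (b : Fin (m + 1) → ℕ) : Prop :=
  StrictMono b ∧ b 0 = 0 ∧ b (Fin.last m) = n ∧
    ∀ (i₁ i₂ : Fin n) (j₁ j₂ : Fin m), j₁ ≠ j₂ →
      b j₁.castSucc ≤ (i₁ : ℕ) → (i₁ : ℕ) < b j₁.succ →
      b j₂.castSucc ≤ (i₂ : ℕ) → (i₂ : ℕ) < b j₂.succ →
      (β i₂ < β i₁ ↔ α j₂ < α j₁)

/-- `β` is a `k`-blow-up of `α`: a blow-up in which every block has size `k`. -/
def IsUniformBlowUp {m n : ℕ} (k : ℕ) (α : Equiv.Perm (Fin m)) (β : Equiv.Perm (Fin n)) : Prop :=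
  ∃ b : Fin (m + 1) → ℕ, IsBlowUpWith α β b ∧ ∀ j : Fin m, b j.succ = b j.castSucc + k

/-- The blow-up parameter `k*(α)`: the least positive `k` such that no `k`-blow-up of `α` has the
property `P`, and `∞` if there is no such `k`. -/
def kStarPerm (P : PermProperty) {m : ℕ} (α : Equiv.Perm (Fin m)) : ℕ∞ :=
  ⨅ k ∈ {k : ℕ | 0 < k ∧
    ∀ (n : ℕ) (β : Equiv.Perm (Fin n)), IsUniformBlowUp k α β → β ∉ P n}, (k : ℕ∞)

open Classical in
/-- The blow-up parameter `k*(T)`: the maximum of `k*(α)` over all `α` of length `T` for which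
`k*(α)` is finite, and `∞` if there is no such `α`. -/
def kStar (P : PermProperty) (T : ℕ) : ℕ∞ :=
  if ∃ α : Equiv.Perm (Fin T), kStarPerm P α ≠ ⊤ then
    ⨆ α ∈ {α : Equiv.Perm (Fin T) | kStarPerm P α ≠ ⊤}, kStarPerm P α
  else ⊤

/-! ### Distances -/

/-- `σ` arises from `π` by one planar simple transposition: two entries in adjacent positions are
exchanged (`σ = π ∘ (i i+1)`), or two adjacent values are exchanged (`σ = (i i+1) ∘ π`). -/
def PlanarStep {n : ℕ} (π σ : Equiv.Perm (Fin n)) : Prop :=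
  ∃ i i' : Fin n, (i' : ℕ) = (i : ℕ) + 1 ∧
    (σ = π * Equiv.swap i i' ∨ σ = Equiv.swap i i' * π)

/-- `π` can be transformed into `σ` by `t` planar simple transpositions. -/
def PlanarReach {n : ℕ} (t : ℕ) (π σ : Equiv.Perm (Fin n)) : Prop :=
  ∃ c : ℕ → Equiv.Perm (Fin n), c 0 = π ∧ c t = σ ∧ ∀ s < t, PlanarStep (c s) (c (s + 1))

/-- The planar tau distance. -/
def planarTau {n : ℕ} (π σ : Equiv.Perm (Fin n)) : ℝ :=
  (sInf {t : ℕ | PlanarReach t π σ} : ℕ) / (n.choose 2 : ℝ)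

/-- The earth mover's distance. -/
def emd {n : ℕ} (π σ : Equiv.Perm (Fin n)) : ℝ :=
  (⨅ θ : Equiv.Perm (Fin n), ∑ i : Fin n,
    (|((i : ℕ) : ℝ) - ((θ i : ℕ) : ℝ)| + |((π i : ℕ) : ℝ) - ((σ (θ i) : ℕ) : ℝ)|)) /
      (n.choose 2 : ℝ)

open Classical in
/-- The distance from `π` to the property `P`: the minimum of the distance `d` over the members
of `P` of the same length as `π`, and `1` if `P` has no member of that length. -/
def distTo (d : ∀ n : ℕ, Equiv.Perm (Fin n) → Equiv.Perm (Fin n) → ℝ) (P : PermProperty)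
    {n : ℕ} (π : Equiv.Perm (Fin n)) : ℝ :=
  if (P n).Nonempty then ⨅ σ : P n, d n π σ else 1

/-! ### Testers -/

/-- The possible outcomes of an `M`-sample of positions: the `M`-element subsets of `Fin n`. -/
abbrev Sample (n M : ℕ) : Type := {S : Finset (Fin n) // S.card = M}

/-- The subpermutation of `π` induced on the set of positions `S`. -/
def induced {n M : ℕ} (π : Equiv.Perm (Fin n)) (S : Sample n M) : Equiv.Perm (Fin M) :=
  ((S.1.orderIsoOfFin S.2).toEquiv.trans
    (π.subtypeEquiv (p := fun a => a ∈ S.1) (q := fun a => a ∈ S.1.map π.toEmbedding)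
      (fun a => by simp))).trans
    ((S.1.map π.toEmbedding).orderIsoOfFin
      ((Finset.card_map _).trans S.2)).symm.toEquiv

/-- The induced permutation has the same order type as the sampled entries of `π`. -/
theorem induced_lt_iff {n M : ℕ} (π : Equiv.Perm (Fin n)) (S : Sample n M) (j l : Fin M) :
    induced π S j < induced π S l ↔
      π (S.1.orderEmbOfFin S.2 j) < π (S.1.orderEmbOfFin S.2 l) := by
  simp only [induced, Equiv.trans_apply, OrderIso.coe_toEquiv]
  rw [OrderIso.lt_iff_lt]
  rfl

/-- The probability, over a uniformly random `M`-sample from `π`, that the induced subpermutation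
lies in the set `A`. -/
def sampleProb {n M : ℕ} (π : Equiv.Perm (Fin n)) (A : Set (Equiv.Perm (Fin M))) : ℝ :=
  (Nat.card {S : Sample n M // induced π S ∈ A} : ℝ) / (Nat.card (Sample n M) : ℝ)

/-- `A` (the set of accepted outcomes) is a two-sided `ε`-tester for `P` with respect to the
distance `d`, with `M` queries and success probability at least `p`, on permutations whose length
satisfies `L`. The tester queries `π` at `M` positions chosen uniformly at random, looks at the
induced subpermutation of length `M`, answers "`π` has `P`" if that permutation is in `A` and
"`π` does not have `P`" otherwise. -/
def IsTwoSidedTester (d : ∀ n : ℕ, Equiv.Perm (Fin n) → Equiv.Perm (Fin n) → ℝ)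
    (P : PermProperty) (ε p : ℝ) (M : ℕ) (L : ℕ → Prop) (A : Set (Equiv.Perm (Fin M))) : Prop :=
  ∀ n : ℕ, M ≤ n → L n → ∀ π : Equiv.Perm (Fin n),
    (π ∈ P n → p ≤ sampleProb π A) ∧
    (ε ≤ distTo d P π → p ≤ sampleProb π Aᶜ)

/-- The sample size `M(ε) = 20000 / ε²`, rounded up to an integer. -/
def sampleSize (ε : ℝ) : ℕ := ⌈20000 / ε ^ 2⌉₊

/-- The threshold `n₀ = 32 M⁵ k*(M) / ε³`, infinite if `k*(M) = ∞`. -/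
def sizeThreshold (P : PermProperty) (ε : ℝ) (M : ℕ) : ℝ≥0∞ :=
  32 * (M : ℝ≥0∞) ^ 5 * (kStar P M : ℝ≥0∞) / ENNReal.ofReal (ε ^ 3)

end

end PermTesting

namespace PermTesting
open Finset

/-! ### Random samples -/

/-- The probability that a uniformly random `M`-subset of an `n`-set misses a given `r`-subset. -/
noncomputable def missProb (n M r : ℕ) : ℝ := ((n - r).choose M : ℝ) / (n.choose M : ℝ)

theorem choose_mul_choose_le (n M a b : ℕ) :
    (n - (a + b)).choose M * n.choose M ≤ (n - a).choose M * (n - b).choose M := by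
  have key : (n - (a + b)).descFactorial M * n.descFactorial M ≤
      (n - a).descFactorial M * (n - b).descFactorial M := by
    simp only [Nat.descFactorial_eq_prod_range]
    rw [← Finset.prod_mul_distrib, ← Finset.prod_mul_distrib]
    refine Finset.prod_le_prod' fun j _ => ?_
    rcases le_total (n - j) (a + b) with h | h
    · have : n - (a + b) - j = 0 := by omega
      simp [this]
    · obtain ⟨c, hc⟩ := Nat.exists_eq_add_of_le h
      have h1 : n - (a + b) - j = c := by omega
      have h2 : n - a - j = b + c := by omega
      have h3 : n - b - j = a + c := by omega
      rw [h1, h2, h3, hc]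
      nlinarith [Nat.zero_le (a * b)]
  simp only [Nat.descFactorial_eq_factorial_mul_choose] at key
  have hM : 0 < M.factorial * M.factorial := by positivity
  refine Nat.le_of_mul_le_mul_left ?_ hM
  calc _ = _ := by ring
    _ ≤ _ := key
    _ = _ := by ring

section Sampling

variable {n M : ℕ}

theorem missProb_nonneg (r : ℕ) : 0 ≤ missProb n M r := by unfold missProb; positivity

theorem missProb_zero (h : M ≤ n) : missProb n M 0 = 1 := by
  have : (0 : ℝ) < n.choose M := by exact_mod_cast Nat.choose_pos h
  simp [missProb, this.ne']

theorem missProb_add_le (h : M ≤ n) (a b : ℕ) :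
    missProb n M (a + b) ≤ missProb n M a * missProb n M b := by
  have hN : (0 : ℝ) < n.choose M := by exact_mod_cast Nat.choose_pos h
  unfold missProb
  rw [div_mul_div_comm, div_le_div_iff₀ hN (by positivity)]
  have : ((n - (a + b)).choose M * n.choose M : ℝ) ≤ (n - a).choose M * (n - b).choose M := by
    exact_mod_cast choose_mul_choose_le n M a b
  nlinarith

theorem missProb_one (h : M ≤ n) (hn : 0 < n) : missProb n M 1 = 1 - M / n := by
  have hN : (0 : ℝ) < n.choose M := by exact_mod_cast Nat.choose_pos h
  have hn' : (0 : ℝ) < n := by exact_mod_cast hn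
  unfold missProb
  obtain ⟨m, rfl⟩ : ∃ m, n = m + 1 := ⟨n - 1, by omega⟩
  have := Nat.choose_mul_succ_eq m M
  have h' : (m.choose M : ℝ) * ((m : ℝ) + 1) = (m + 1).choose M * ((m : ℝ) + 1 - M) := by
    rw [← Nat.cast_add_one, ← Nat.cast_sub h]; exact_mod_cast this
  push_cast at hn' ⊢
  field_simp
  linarith

theorem missProb_le_pow (h : M ≤ n) (r : ℕ) : missProb n M r ≤ missProb n M 1 ^ r := by
  induction r with
  | zero => simp [missProb_zero h]
  | succ r ih =>
    rw [pow_succ]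
    exact (missProb_add_le h r 1).trans (mul_le_mul_of_nonneg_right ih (missProb_nonneg 1))

theorem card_sample : Fintype.card (Sample n M) = n.choose M := by
  rw [Fintype.card_finset_len, Fintype.card_fin]

theorem card_samples_disjoint (U : Finset (Fin n)) :
    #{S : Sample n M | Disjoint U S.1} = (n - #U).choose M := by
  have hU : n - #U = #Uᶜ := by rw [Finset.card_compl, Fintype.card_fin]
  rw [hU, ← Finset.card_powersetCard]
  refine Finset.card_bij (fun S _ => S.1) ?_ (fun _ _ _ _ h => Subtype.ext h) ?_
  · intro S hS
    simp only [mem_filter, mem_univ, true_and] at hS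
    rw [mem_powersetCard]
    exact ⟨by rw [Finset.subset_compl_comm]; intro x hx; rw [mem_compl]; exact Finset.disjoint_left.1 hS hx, S.2⟩
  · intro T hT
    rw [mem_powersetCard] at hT
    refine ⟨⟨T, hT.2⟩, ?_, rfl⟩
    simp only [mem_filter, mem_univ, true_and]
    exact Finset.disjoint_left.2 fun x hx hx' => (mem_compl.1 (hT.1 hx')) hx

theorem sum_disjoint (h : M ≤ n) (U : Finset (Fin n)) :
    ∑ S : Sample n M, (if Disjoint U S.1 then (1 : ℝ) else 0) =
      missProb n M #U * n.choose M := by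
  have hN : (0 : ℝ) < n.choose M := by exact_mod_cast Nat.choose_pos h
  rw [Finset.sum_boole, card_samples_disjoint, missProb]
  field_simp

theorem card_samples_mem (h : M ≤ n) (hn : 0 < n) (i : Fin n) :
    (#{S : Sample n M | i ∈ S.1} : ℝ) = M / n * n.choose M := by
  have h1 := sum_disjoint h ({i} : Finset (Fin n))
  rw [card_singleton, missProb_one h hn] at h1
  have h2 : (#{S : Sample n M | i ∈ S.1} : ℝ) =
      ∑ S : Sample n M, (1 - if Disjoint {i} S.1 then (1 : ℝ) else 0) := by
    rw [← Finset.sum_boole]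
    refine Finset.sum_congr rfl fun S _ => ?_
    by_cases hi : i ∈ S.1 <;> simp [hi]
  rw [h2, Finset.sum_sub_distrib, h1, Finset.sum_const, card_univ, card_sample]
  simp; ring

theorem card_samples_mem_mem_le (h : M ≤ n) (hn : 0 < n) {i j : Fin n} (hij : i ≠ j) :
    (#{S : Sample n M | i ∈ S.1 ∧ j ∈ S.1} : ℝ) ≤ (M / n) ^ 2 * n.choose M := by
  have hN : (0 : ℝ) < n.choose M := by exact_mod_cast Nat.choose_pos h
  have h1 := sum_disjoint h ({i} : Finset (Fin n))
  have h1' := sum_disjoint h ({j} : Finset (Fin n))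
  have h3 := sum_disjoint h ({i, j} : Finset (Fin n))
  rw [card_singleton, missProb_one h hn] at h1 h1'
  rw [card_pair hij] at h3
  have h2 : (#{S : Sample n M | i ∈ S.1 ∧ j ∈ S.1} : ℝ) =
      ∑ S : Sample n M, (1 - (if Disjoint {i} S.1 then (1 : ℝ) else 0)
        - (if Disjoint {j} S.1 then (1 : ℝ) else 0)
        + if Disjoint {i, j} S.1 then (1 : ℝ) else 0) := by
    rw [← Finset.sum_boole]
    refine Finset.sum_congr rfl fun S _ => ?_
    by_cases hi : i ∈ S.1 <;> by_cases hj : j ∈ S.1 <;> simp [hi, hj]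
  have h4 := missProb_add_le h 1 1
  rw [missProb_one h hn] at h4
  rw [h2, Finset.sum_add_distrib, Finset.sum_sub_distrib, Finset.sum_sub_distrib, h1, h1', h3,
    Finset.sum_const, card_univ, card_sample]
  simp only [nsmul_eq_mul, mul_one]
  have := mul_le_mul_of_nonneg_right h4 hN.le
  norm_num at this
  nlinarith

/-- Chebyshev's inequality for a weighted number of missed sets: events from different classes
concern disjoint sets, and are therefore negatively correlated. -/
theorem card_samples_missed_ge {ι κ : Type*} [Fintype ι] [Fintype κ] [DecidableEq κ]
    (h : M ≤ n) (c : ι → ℝ) (hc : ∀ a, 0 ≤ c a) (U : ι → Finset (Fin n)) (cl : ι → κ)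
    (hU : ∀ a b, cl a ≠ cl b → Disjoint (U a) (U b)) (y : ℝ) (hy0 : 0 ≤ y) (hy1 : y ≤ 1)
    (hy : missProb n M 1 ≤ y ^ 2) (G : ℝ)
    (hG : ∀ s, ∑ a with cl a = s, c a * y ^ #(U a) ≤ G) (t : ℝ) (ht : 0 < t) :
    (#{S : Sample n M | Fintype.card κ * G + t ≤
      ∑ a, c a * if Disjoint (U a) S.1 then (1 : ℝ) else 0} : ℝ) * t ^ 2 ≤
      Fintype.card κ * G ^ 2 * n.choose M := by
  have hN : (0 : ℝ) < n.choose M := by exact_mod_cast Nat.choose_pos h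
  set N : ℝ := (n.choose M : ℝ)
  set X : Sample n M → ℝ := fun S => ∑ a, c a * if Disjoint (U a) S.1 then (1 : ℝ) else 0 with hX
  set μ : ℝ := ∑ a, c a * missProb n M #(U a) with hμ
  have hmiss : ∀ r, missProb n M r ≤ (y ^ 2) ^ r := fun r =>
    (missProb_le_pow h r).trans (pow_le_pow_left₀ (missProb_nonneg 1) hy r)
  have hmiss' : ∀ r, missProb n M r ≤ y ^ r := fun r =>
    (hmiss r).trans (pow_le_pow_left₀ (by positivity) (by nlinarith) r)
  have hEX : ∑ S, X S = μ * N := by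
    simp only [hX]
    rw [Finset.sum_comm, hμ, Finset.sum_mul]
    refine Finset.sum_congr rfl fun a _ => ?_
    rw [← Finset.mul_sum, sum_disjoint h, mul_assoc]
  have hμle : μ ≤ Fintype.card κ * G := by
    calc μ ≤ ∑ a, c a * y ^ #(U a) :=
          Finset.sum_le_sum fun a _ => mul_le_mul_of_nonneg_left (hmiss' _) (hc a)
      _ = ∑ s, ∑ a with cl a = s, c a * y ^ #(U a) := (Finset.sum_fiberwise _ _ _).symm
      _ ≤ ∑ s : κ, G := Finset.sum_le_sum fun s _ => hG s
      _ = _ := by simp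
  have hpair : ∀ a b, c a * c b * missProb n M #(U a ∪ U b) ≤
      (c a * missProb n M #(U a)) * (c b * missProb n M #(U b)) +
        if cl a = cl b then (c a * y ^ #(U a)) * (c b * y ^ #(U b)) else 0 := by
    intro a b
    have hcc := mul_nonneg (hc a) (hc b)
    split_ifs with hab
    · have h1 : missProb n M #(U a ∪ U b) ≤ y ^ #(U a) * y ^ #(U b) := by
        refine (hmiss _).trans ?_
        rw [← pow_mul, ← pow_add]
        refine pow_le_pow_of_le_one hy0 hy1 ?_
        have := Finset.card_le_card (Finset.subset_union_left (s₁ := U a) (s₂ := U b))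
        have := Finset.card_le_card (Finset.subset_union_right (s₁ := U a) (s₂ := U b))
        omega
      have h2 := mul_nonneg (mul_nonneg (hc a) (missProb_nonneg (n := n) (M := M) #(U a)))
        (mul_nonneg (hc b) (missProb_nonneg (n := n) (M := M) #(U b)))
      have := mul_le_mul_of_nonneg_left h1 hcc
      linarith
    · rw [Finset.card_union_of_disjoint (hU a b hab), add_zero]
      have := mul_le_mul_of_nonneg_left (missProb_add_le h #(U a) #(U b)) hcc
      linarith
  have hEX2 : ∑ S, X S ^ 2 ≤ (μ ^ 2 + Fintype.card κ * G ^ 2) * N := by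
    have h1 : ∑ S, X S ^ 2 = ∑ a, ∑ b, c a * c b * missProb n M #(U a ∪ U b) * N := by
      have : ∀ S, X S ^ 2 = ∑ a, ∑ b, c a * c b *
          (if Disjoint (U a ∪ U b) S.1 then (1 : ℝ) else 0) := by
        intro S
        rw [sq, hX, Finset.sum_mul_sum]
        refine Finset.sum_congr rfl fun a _ => Finset.sum_congr rfl fun b _ => ?_
        by_cases ha : Disjoint (U a) S.1 <;> by_cases hb : Disjoint (U b) S.1 <;> simp [ha, hb]
      simp only [this]
      rw [Finset.sum_comm]
      refine Finset.sum_congr rfl fun a _ => ?_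
      rw [Finset.sum_comm]
      refine Finset.sum_congr rfl fun b _ => ?_
      rw [← Finset.mul_sum, sum_disjoint h, ← mul_assoc]
    have h2 : ∑ a, ∑ b, (if cl a = cl b then (c a * y ^ #(U a)) * (c b * y ^ #(U b)) else 0) ≤
        Fintype.card κ * G ^ 2 := by
      calc _ = ∑ s, (∑ a with cl a = s, c a * y ^ #(U a)) ^ 2 := by
            rw [← Finset.sum_fiberwise _ cl]
            refine Finset.sum_congr rfl fun s _ => ?_
            rw [sq, Finset.sum_mul_sum]
            refine Finset.sum_congr rfl fun a ha => ?_
            rw [Finset.sum_filter]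
            refine Finset.sum_congr rfl fun b _ => ?_
            rw [(Finset.mem_filter.1 ha).2]
            simp only [eq_comm]
        _ ≤ ∑ s : κ, G ^ 2 := Finset.sum_le_sum fun s _ =>
            pow_le_pow_left₀ (Finset.sum_nonneg fun a _ => mul_nonneg (hc a) (by positivity)) (hG s) 2
        _ = _ := by simp
    calc ∑ S, X S ^ 2 = (∑ a, ∑ b, c a * c b * missProb n M #(U a ∪ U b)) * N := by
          rw [h1]; simp only [Finset.sum_mul]
      _ ≤ (∑ a, ∑ b, ((c a * missProb n M #(U a)) * (c b * missProb n M #(U b)) +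
        if cl a = cl b then (c a * y ^ #(U a)) * (c b * y ^ #(U b)) else 0)) * N :=
          mul_le_mul_of_nonneg_right
            (Finset.sum_le_sum fun a _ => Finset.sum_le_sum fun b _ => hpair a b) hN.le
      _ ≤ _ := by
          simp only [Finset.sum_add_distrib]
          rw [← Finset.sum_mul_sum, ← hμ, ← sq]
          exact mul_le_mul_of_nonneg_right (by linarith) hN.le
  have hvar : ∑ S, (X S - μ) ^ 2 ≤ Fintype.card κ * G ^ 2 * N := by
    have : ∑ S, (X S - μ) ^ 2 = ∑ S, X S ^ 2 - 2 * μ * ∑ S, X S + μ ^ 2 * N := by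
      rw [Finset.mul_sum, ← Finset.sum_sub_distrib]
      have h3 : μ ^ 2 * N = ∑ S : Sample n M, μ ^ 2 := by
        rw [Finset.sum_const, card_univ, card_sample, nsmul_eq_mul, mul_comm]
      rw [h3, ← Finset.sum_add_distrib]
      exact Finset.sum_congr rfl fun S _ => by ring
    rw [this, hEX]
    linarith
  refine le_trans ?_ hvar
  rw [← nsmul_eq_mul, ← Finset.sum_const]
  refine (Finset.sum_le_sum fun S hS => ?_).trans
    (Finset.sum_le_sum_of_subset_of_nonneg (Finset.filter_subset _ _) fun S _ _ => sq_nonneg _)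
  have := (Finset.mem_filter.1 hS).2
  exact pow_le_pow_left₀ ht.le (by linarith) 2

end Sampling

/-! ### The planar tau distance is at most the earth mover's distance -/

section Distances

variable {n : ℕ}

theorem PlanarReach.refl (π : Equiv.Perm (Fin n)) : PlanarReach 0 π π :=
  ⟨fun _ => π, rfl, rfl, fun s hs => absurd hs (Nat.not_lt_zero s)⟩

theorem PlanarStep.reach {π σ : Equiv.Perm (Fin n)} (h : PlanarStep π σ) : PlanarReach 1 π σ :=
  ⟨fun t => if t = 0 then π else σ, by simp, by simp, fun s hs => by
    obtain rfl : s = 0 := by omega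
    simpa using h⟩

theorem PlanarReach.trans {s t : ℕ} {π σ τ : Equiv.Perm (Fin n)} (h₁ : PlanarReach s π σ)
    (h₂ : PlanarReach t σ τ) : PlanarReach (s + t) π τ := by
  obtain ⟨c, hc0, hcs, hc⟩ := h₁
  obtain ⟨d, hd0, hdt, hd⟩ := h₂
  refine ⟨fun r => if r ≤ s then c r else d (r - s), by simp [hc0], ?_, fun r hr => ?_⟩
  · by_cases ht : t = 0
    · subst ht
      simp [hcs, ← hd0, hdt]
    · simp [ht, hdt]
  · rcases lt_trichotomy r s with h | h | h
    · simpa [h.le, Nat.succ_le_of_lt h] using hc r h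
    · subst h
      have := hd 0 (by omega)
      simpa [hcs, ← hd0] using this
    · have := hd (r - s) (by omega)
      have e : r + 1 - s = r - s + 1 := by omega
      simpa [not_le.2 h, not_le.2 (h.trans (Nat.lt_succ_self r)), e] using this

theorem PlanarReach.inv {t : ℕ} {π σ : Equiv.Perm (Fin n)} (h : PlanarReach t π σ) :
    PlanarReach t π⁻¹ σ⁻¹ := by
  obtain ⟨c, hc0, hct, hc⟩ := h
  refine ⟨fun s => (c s)⁻¹, by simp [hc0], by simp [hct], fun s hs => ?_⟩
  obtain ⟨i, i', hi, h | h⟩ := hc s hs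
  · exact ⟨i, i', hi, Or.inr (by simp [h])⟩
  · exact ⟨i, i', hi, Or.inl (by simp [h])⟩

theorem planarReach_mul_swap (d : ℕ) : ∀ (π : Equiv.Perm (Fin n)) (i j : Fin n),
    (j : ℕ) = i + d → ∃ t ≤ 2 * d, PlanarReach t π (π * Equiv.swap i j) := by
  induction d with
  | zero =>
    intro π i j h
    obtain rfl : i = j := Fin.ext (by omega)
    exact ⟨0, le_rfl, by rw [Equiv.swap_self]; exact PlanarReach.refl π⟩
  | succ d ih =>
    intro π i j h
    have hj := j.2
    set k : Fin n := ⟨i + d, by omega⟩ with hk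
    by_cases hd : d = 0
    · exact ⟨1, by omega, (PlanarStep.reach ⟨i, j, by omega, Or.inl rfl⟩)⟩
    have step : ∀ ρ : Equiv.Perm (Fin n), PlanarReach 1 ρ (ρ * Equiv.swap k j) := fun ρ =>
      PlanarStep.reach ⟨k, j, by simp [hk]; omega, Or.inl rfl⟩
    obtain ⟨t, ht, hr⟩ := ih (π * Equiv.swap k j) i k (by simp [hk])
    refine ⟨1 + t + 1, by omega, ?_⟩
    have e : Equiv.swap k j * Equiv.swap i k * Equiv.swap k j = Equiv.swap i j := by
      have hik : i ≠ k := fun e => by have := congrArg Fin.val e; simp [hk] at this; omega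
      have hij : i ≠ j := fun e => by have := congrArg Fin.val e; omega
      rw [Equiv.swap_mul_swap_mul_swap hik hij, Equiv.swap_comm]
    rw [← e, ← mul_assoc, ← mul_assoc]
    exact ((step π).trans hr).trans (step _)

/-- The total displacement of a permutation. -/
def displacement (τ : Equiv.Perm (Fin n)) : ℤ := ∑ i : Fin n, |((i : ℕ) : ℤ) - ((τ i : ℕ) : ℤ)|

theorem exists_crossing (τ : Equiv.Perm (Fin n)) (hτ : τ ≠ 1) :
    ∃ i j : Fin n, i < j ∧ j ≤ τ i ∧ τ j ≤ i := by
  have hne : ∃ i, i < τ i := by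
    by_contra! hcon
    apply hτ
    ext i
    induction i using WellFoundedLT.induction with
    | _ i ih =>
      rcases (hcon i).lt_or_eq with h | h
      · have := ih _ h
        have h2 : τ (τ i) = τ i := Fin.ext this
        have := τ.injective h2
        simp [this]
      · simp [h]
  obtain ⟨i, hi, hmax⟩ : ∃ i, i < τ i ∧ ∀ k, i < k → τ k ≤ k := by
    obtain ⟨i, hi⟩ := Finset.exists_max_image (univ.filter fun i => i < τ i) id
      (by obtain ⟨i, hi⟩ := hne; exact ⟨i, by simpa using hi⟩)
    refine ⟨i, by simpa using hi.1, fun k hk => ?_⟩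
    by_contra! h
    exact absurd (hi.2 k (by simpa using h)) (not_le.2 hk)
  by_contra! hcon
  have hsub : (Finset.Ioc i (τ i)).image τ ⊆ Finset.Ioo i (τ i) := by
    intro x hx
    obtain ⟨k, hk, rfl⟩ := Finset.mem_image.1 hx
    rw [Finset.mem_Ioc] at hk
    refine Finset.mem_Ioo.2 ⟨hcon i k hk.1 hk.2, lt_of_le_of_ne ((hmax k hk.1).trans hk.2) ?_⟩
    exact fun e => hk.1.ne' (τ.injective e)
  have := Finset.card_le_card hsub
  rw [Finset.card_image_of_injective _ τ.injective, Fin.card_Ioc, Fin.card_Ioo] at this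
  have : (i : ℕ) < τ i := hi
  omega

theorem displacement_mul_swap (τ : Equiv.Perm (Fin n)) {i j : Fin n} (hij : i < j)
    (hi : j ≤ τ i) (hj : τ j ≤ i) :
    displacement (τ * Equiv.swap i j) + 2 * ((j : ℤ) - i) = displacement τ := by
  have key : ∀ ρ : Equiv.Perm (Fin n), displacement ρ =
      |((i : ℕ) : ℤ) - ((ρ i : ℕ) : ℤ)| + |((j : ℕ) : ℤ) - ((ρ j : ℕ) : ℤ)| +
        ∑ k ∈ (univ.erase i).erase j, |((k : ℕ) : ℤ) - ((ρ k : ℕ) : ℤ)| := by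
    intro ρ
    unfold displacement
    rw [← Finset.add_sum_erase univ _ (mem_univ i),
      ← Finset.add_sum_erase (univ.erase i) _ (mem_erase.2 ⟨hij.ne', mem_univ j⟩), add_assoc]
  rw [key τ, key (τ * Equiv.swap i j)]
  have hs : ∑ k ∈ (univ.erase i).erase j, |((k : ℕ) : ℤ) - (((τ * Equiv.swap i j) k : ℕ) : ℤ)| =
      ∑ k ∈ (univ.erase i).erase j, |((k : ℕ) : ℤ) - ((τ k : ℕ) : ℤ)| := by
    refine Finset.sum_congr rfl fun k hk => ?_
    simp only [mem_erase] at hk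
    rw [Equiv.Perm.mul_apply, Equiv.swap_apply_of_ne_of_ne hk.2.1 hk.1]
  rw [hs]
  simp only [Equiv.Perm.mul_apply, Equiv.swap_apply_left, Equiv.swap_apply_right]
  have h1 : (i : ℕ) < j := hij
  have h2 : (j : ℕ) ≤ τ i := hi
  have h3 : (τ j : ℕ) ≤ i := hj
  rw [abs_of_nonneg (a := ((i : ℕ) : ℤ) - (τ j : ℕ)) (by omega),
    abs_of_nonpos (a := ((j : ℕ) : ℤ) - (τ i : ℕ)) (by omega),
    abs_of_nonpos (a := ((i : ℕ) : ℤ) - (τ i : ℕ)) (by omega),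
    abs_of_nonneg (a := ((j : ℕ) : ℤ) - (τ j : ℕ)) (by omega)]
  ring

theorem displacement_nonneg (τ : Equiv.Perm (Fin n)) : 0 ≤ displacement τ :=
  Finset.sum_nonneg fun _ _ => abs_nonneg _

theorem planarReach_mul (τ : Equiv.Perm (Fin n)) :
    ∀ π : Equiv.Perm (Fin n), ∃ t : ℕ, (t : ℤ) ≤ displacement τ ∧ PlanarReach t π (π * τ) := by
  induction hd : (displacement τ).toNat using Nat.strong_induction_on generalizing τ with
  | _ d ih =>
    intro π
    by_cases hτ : τ = 1
    · subst hτ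
      exact ⟨0, displacement_nonneg _, by simpa using PlanarReach.refl π⟩
    obtain ⟨i, j, hij, hi, hj⟩ := exists_crossing τ hτ
    have hlt : (i : ℕ) < j := hij
    have h := displacement_mul_swap τ hij hi hj
    have h0 := displacement_nonneg (τ * Equiv.swap i j)
    obtain ⟨t, ht, hr⟩ := ih _ (by omega) (τ * Equiv.swap i j) rfl π
    obtain ⟨s, hs, hr'⟩ := planarReach_mul_swap ((j : ℕ) - i) (π * (τ * Equiv.swap i j)) i j (by omega)
    refine ⟨t + s, by push_cast; omega, ?_⟩
    have e : π * (τ * Equiv.swap i j) * Equiv.swap i j = π * τ := by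
      rw [mul_assoc, mul_assoc, Equiv.swap_mul_self, mul_one]
    rw [e] at hr'
    exact hr.trans hr'

theorem planarReach_of_matching (π σ θ : Equiv.Perm (Fin n)) :
    ∃ t : ℕ, (t : ℤ) ≤ ∑ i : Fin n, (|((i : ℕ) : ℤ) - ((θ i : ℕ) : ℤ)| +
      |((π i : ℕ) : ℤ) - ((σ (θ i) : ℕ) : ℤ)|) ∧ PlanarReach t π σ := by
  obtain ⟨s, hs, hr⟩ := planarReach_mul θ⁻¹ π
  obtain ⟨t, ht, hr'⟩ := planarReach_mul (π * θ⁻¹ * σ⁻¹) (π * θ⁻¹)⁻¹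
  have hr'' := hr'.inv
  have e : ((π * θ⁻¹)⁻¹ * (π * θ⁻¹ * σ⁻¹))⁻¹ = σ := by group
  rw [inv_inv, e] at hr''
  refine ⟨s + t, ?_, hr.trans hr''⟩
  rw [Finset.sum_add_distrib]
  have h1 : displacement θ⁻¹ = ∑ i : Fin n, |((i : ℕ) : ℤ) - ((θ i : ℕ) : ℤ)| := by
    unfold displacement
    rw [← Equiv.sum_comp θ]
    refine Finset.sum_congr rfl fun i _ => ?_
    simp [abs_sub_comm]
  have h2 : displacement (π * θ⁻¹ * σ⁻¹) = ∑ i, |((π i : ℕ) : ℤ) - ((σ (θ i) : ℕ) : ℤ)| := by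
    unfold displacement
    rw [← Equiv.sum_comp (θ.trans σ)]
    refine Finset.sum_congr rfl fun i _ => ?_
    simp [abs_sub_comm]
  push_cast
  linarith

theorem emd_le (π σ θ : Equiv.Perm (Fin n)) : emd π σ ≤ (∑ i : Fin n,
    (|((i : ℕ) : ℝ) - ((θ i : ℕ) : ℝ)| + |((π i : ℕ) : ℝ) - ((σ (θ i) : ℕ) : ℝ)|)) /
      (n.choose 2 : ℝ) :=
  div_le_div_of_nonneg_right (ciInf_le (Set.finite_range _).bddBelow θ) (by positivity)

theorem planarTau_le_emd (π σ : Equiv.Perm (Fin n)) : planarTau π σ ≤ emd π σ := by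
  unfold planarTau emd
  refine div_le_div_of_nonneg_right (le_ciInf fun θ => ?_) (by positivity)
  obtain ⟨t, ht, hr⟩ := planarReach_of_matching π σ θ
  have h1 : sInf {t : ℕ | PlanarReach t π σ} ≤ t := Nat.sInf_le hr
  have h2 : ((t : ℤ) : ℝ) ≤ ((∑ i : Fin n, (|((i : ℕ) : ℤ) - ((θ i : ℕ) : ℤ)| +
      |((π i : ℕ) : ℤ) - ((σ (θ i) : ℕ) : ℤ)|) : ℤ) : ℝ) := Int.cast_le.2 ht
  push_cast at h2
  exact le_trans (Nat.cast_le.2 h1) h2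

theorem emd_le_two (π σ : Equiv.Perm (Fin n)) : emd π σ ≤ 2 := by
  refine (emd_le π σ 1).trans (div_le_of_le_mul₀ (by positivity) (by norm_num) ?_)
  rcases Nat.eq_zero_or_pos n with rfl | hn
  · simp
  have hb : ∀ i : Fin n, |((i : ℕ) : ℝ) - (((1 : Equiv.Perm (Fin n)) i : ℕ) : ℝ)| +
      |((π i : ℕ) : ℝ) - ((σ ((1 : Equiv.Perm (Fin n)) i) : ℕ) : ℝ)| ≤ (n : ℝ) - 1 := by
    intro i
    have h1 : ((π i : ℕ) : ℝ) + 1 ≤ n := by exact_mod_cast (π i).2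
    have h2 : ((σ i : ℕ) : ℝ) + 1 ≤ n := by exact_mod_cast (σ i).2
    simp only [Equiv.Perm.one_apply, sub_self, abs_zero, zero_add]
    rw [abs_le]
    constructor <;> linarith [Nat.cast_nonneg (α := ℝ) (π i : ℕ), Nat.cast_nonneg (α := ℝ) (σ i : ℕ)]
  refine (Finset.sum_le_sum fun i _ => hb i).trans ?_
  rw [Nat.cast_choose_two]
  simp
  linarith

theorem distTo_le (d : ∀ n : ℕ, Equiv.Perm (Fin n) → Equiv.Perm (Fin n) → ℝ)
    (P : PermProperty) (π : Equiv.Perm (Fin n)) {σ : Equiv.Perm (Fin n)} (hσ : σ ∈ P n) :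
    distTo d P π ≤ d n π σ := by
  unfold distTo
  rw [if_pos ⟨σ, hσ⟩]
  exact ciInf_le (f := fun σ : P n => d n π σ) (Set.finite_range _).bddBelow ⟨σ, hσ⟩

theorem distTo_le_two (d : ∀ n : ℕ, Equiv.Perm (Fin n) → Equiv.Perm (Fin n) → ℝ)
    (hd : ∀ (n : ℕ) (π σ : Equiv.Perm (Fin n)), d n π σ ≤ emd π σ)
    (P : PermProperty) (π : Equiv.Perm (Fin n)) : distTo d P π ≤ 2 := by
  by_cases h : (P n).Nonempty
  · obtain ⟨σ, hσ⟩ := h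
    exact (distTo_le d P π hσ).trans ((hd n π σ).trans (emd_le_two π σ))
  · unfold distTo
    rw [if_neg h]
    norm_num

end Distances

/-! ### Members of the property near a permutation whose sample can be blown up -/

section Closeness

variable {n M : ℕ}

theorem exists_orderType {γ : Type*} [LinearOrder γ] (v : Fin n → γ)
    (hv : Function.Injective v) :
    ∃ ρ : Equiv.Perm (Fin n), ∀ i j, ρ i < ρ j ↔ v i < v j := by
  refine ⟨(Tuple.sort v).symm, fun i j => ?_⟩
  have h : StrictMono (v ∘ Tuple.sort v) :=
    (Tuple.monotone_sort v).strictMono_of_injective (hv.comp (Equiv.injective _))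
  rw [← h.lt_iff_lt]
  simp

theorem abs_sub_eq_sum_range {a b n : ℕ} (ha : a ≤ n) (hb : b ≤ n) :
    |(a : ℝ) - b| = ∑ t ∈ range n, |(if a ≤ t then (1 : ℝ) else 0) - if b ≤ t then 1 else 0| := by
  wlog hab : a ≤ b generalizing a b
  · rw [abs_sub_comm, this hb ha (le_of_not_ge hab)]
    simp only [abs_sub_comm]
  have h : ∀ t, |(if a ≤ t then (1 : ℝ) else 0) - if b ≤ t then 1 else 0| =
      if a ≤ t ∧ t < b then 1 else 0 := by
    intro t
    by_cases h1 : a ≤ t <;> by_cases h2 : b ≤ t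
    · simp [h1, h2]
    · simp [h1, h2, lt_of_not_ge h2]
    · omega
    · simp [h1, h2]
  simp only [h]
  rw [Finset.sum_boole]
  have h' : (range n).filter (fun t => a ≤ t ∧ t < b) = Finset.Ico a b := by
    ext t
    simp only [mem_filter, mem_range, Finset.mem_Ico]
    omega
  rw [h', Nat.card_Ico, Nat.cast_sub hab, abs_sub_comm, abs_of_nonneg]
  simpa using hab

/-- A monotone rearrangement of `v` is the bijection nearest to `v`, so it is at most twice as far
from another bijection as `v` is. -/
theorem sum_abs_sub_le_two_mul (u r : Equiv.Perm (Fin n)) (v : Fin n → Fin n)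
    (h : ∀ i j, v i < v j → r i < r j) :
    ∑ i, |((u i : ℕ) : ℝ) - (r i : ℕ)| ≤ 2 * ∑ i, |((u i : ℕ) : ℝ) - (v i : ℕ)| := by
  have key : ∑ i, |((r i : ℕ) : ℝ) - (v i : ℕ)| ≤ ∑ i, |((u i : ℕ) : ℝ) - (v i : ℕ)| := by
    simp only [fun i => abs_sub_eq_sum_range (r i).2.le (v i).2.le,
      fun i => abs_sub_eq_sum_range (u i).2.le (v i).2.le]
    rw [Finset.sum_comm, Finset.sum_comm (s := univ)]
    refine Finset.sum_le_sum fun t _ => ?_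
    have hsum : ∑ i, ((if (r i : ℕ) ≤ t then (1 : ℝ) else 0) - if (v i : ℕ) ≤ t then 1 else 0) =
        ∑ i, ((if (u i : ℕ) ≤ t then (1 : ℝ) else 0) - if (v i : ℕ) ≤ t then 1 else 0) := by
      rw [Finset.sum_sub_distrib, Finset.sum_sub_distrib,
        Equiv.sum_comp r (fun x : Fin n => if (x : ℕ) ≤ t then (1 : ℝ) else 0),
        Equiv.sum_comp u (fun x : Fin n => if (x : ℕ) ≤ t then (1 : ℝ) else 0)]
    refine le_trans (le_of_eq ?_) ((congrArg abs hsum).trans_le (Finset.abs_sum_le_sum_abs _ _))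
    by_cases hex : ∃ i, (v i : ℕ) ≤ t ∧ t < (r i : ℕ)
    · obtain ⟨i, hi, hi'⟩ := hex
      have hle : ∀ j, ((if (r j : ℕ) ≤ t then (1 : ℝ) else 0) - if (v j : ℕ) ≤ t then 1 else 0) ≤ 0 := by
        intro j
        by_cases h1 : (r j : ℕ) ≤ t
        · have h2 : (v j : ℕ) ≤ t := by
            by_contra! h2
            have : (r i : ℕ) < r j := h i j (show (v i : ℕ) < v j by omega)
            omega
          simp [h1, h2]
        · split_ifs <;> simp
      rw [abs_of_nonpos (Finset.sum_nonpos fun j _ => hle j), ← Finset.sum_neg_distrib]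
      exact Finset.sum_congr rfl fun j _ => abs_of_nonpos (hle j)
    · push Not at hex
      have hge : ∀ j, 0 ≤ ((if (r j : ℕ) ≤ t then (1 : ℝ) else 0) - if (v j : ℕ) ≤ t then 1 else 0) := by
        intro j
        by_cases h1 : (v j : ℕ) ≤ t
        · simp [h1, hex j h1]
        · simp only [h1, if_false, sub_zero]
          split_ifs <;> simp
      rw [abs_of_nonneg (Finset.sum_nonneg fun j _ => hge j)]
      exact Finset.sum_congr rfl fun j _ => abs_of_nonneg (hge j)
  calc _ ≤ ∑ i, (|((u i : ℕ) : ℝ) - (v i : ℕ)| + |((r i : ℕ) : ℝ) - (v i : ℕ)|) :=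
        Finset.sum_le_sum fun i _ => by
          rw [abs_sub_comm ((r i : ℕ) : ℝ)]
          exact abs_sub_le _ _ _
    _ ≤ _ := by rw [Finset.sum_add_distrib]; linarith

theorem exists_blowUp_mem {P : PermProperty} {α : Equiv.Perm (Fin M)} (h : kStarPerm P α = ⊤)
    {k : ℕ} (hk : 0 < k) :
    ∃ (N : ℕ) (β : Equiv.Perm (Fin N)), IsUniformBlowUp k α β ∧ β ∈ P N := by
  by_contra! hcon
  have : kStarPerm P α ≤ (k : ℕ∞) := iInf₂_le k ⟨hk, hcon⟩
  rw [h, top_le_iff] at this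
  exact ENat.natCast_ne_top k this

theorem exists_mem_emd_le {P : PermProperty} (hP : Hereditary P) (π : Equiv.Perm (Fin n))
    (S : Sample n M) (hS : kStarPerm P (induced π S) = ⊤) (a : Fin n → Fin M) :
    ∃ σ ∈ P n, emd π σ ≤ 2 * (∑ i : Fin n,
      (|((i : ℕ) : ℝ) - ((S.1.orderEmbOfFin S.2 (a i) : Fin n) : ℕ)| +
        |((π i : ℕ) : ℝ) - (π (S.1.orderEmbOfFin S.2 (a i)) : ℕ)|)) / (n.choose 2 : ℝ) := by
  obtain ⟨N, β, ⟨b, ⟨hbm, hb0, hbN, hb⟩, hbs⟩, hβ⟩ := exists_blowUp_mem hS (Nat.succ_pos n)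
  have hlt : ∀ i, b (a i).castSucc + i < b (a i).succ := fun i => by rw [hbs]; omega
  have hN : ∀ j : Fin M, b j.succ ≤ N := fun j => hbN ▸ hbm.monotone (Fin.le_last _)
  set g : Fin n → Fin N := fun i => ⟨b (a i).castSucc + i, (hlt i).trans_le (hN _)⟩ with hg
  have hglt : ∀ i j, a i < a j → g i < g j := by
    intro i j hij
    have h1 : b (a i).succ ≤ b (a j).castSucc := hbm.monotone (Fin.succ_le_castSucc_iff.2 hij)
    have h2 := hlt i
    exact Fin.lt_def.2 (show b (a i).castSucc + (i : ℕ) < b (a j).castSucc + j by omega)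
  have hginj : Function.Injective g := by
    intro i j hij
    rcases lt_trichotomy (a i) (a j) with h | h | h
    · exact absurd hij (hglt i j h).ne
    · have : b (a i).castSucc + (i : ℕ) = b (a j).castSucc + j := congrArg Fin.val hij
      rw [h] at this
      exact Fin.ext (by omega)
    · exact absurd hij (hglt j i h).ne'
  obtain ⟨θ, hθ⟩ := exists_orderType g hginj
  obtain ⟨τ, hτ⟩ := exists_orderType (fun i => β (g i)) (β.injective.comp hginj)
  have hf : StrictMono fun x => g (θ.symm x) := fun x y hxy => (hθ _ _).1 (by simpa using hxy)
  refine ⟨θ.symm.trans τ, hP _ _ _ β hβ ⟨OrderEmbedding.ofStrictMono _ hf, fun j l => ?_⟩, ?_⟩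
  · simp [hτ]
  refine (emd_le π _ θ).trans (div_le_div_of_nonneg_right ?_ (by positivity))
  rw [Finset.sum_add_distrib, Finset.sum_add_distrib, mul_add]
  refine add_le_add ?_ ?_
  · refine sum_abs_sub_le_two_mul 1 θ (fun i => S.1.orderEmbOfFin S.2 (a i)) fun i j hij => ?_
    exact (hθ i j).2 (hglt i j ((OrderEmbedding.lt_iff_lt _).1 hij))
  · simp only [Equiv.trans_apply, Equiv.symm_apply_apply]
    refine sum_abs_sub_le_two_mul π τ (fun i => π (S.1.orderEmbOfFin S.2 (a i))) fun i j hij => ?_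
    have hij' := (induced_lt_iff π S (a i) (a j)).2 hij
    refine (hτ i j).2 ((hb (g j) (g i) (a j) (a i) ?_ ?_ (hlt j) ?_ (hlt i)).2 hij')
    · exact fun e => by rw [e] at hij'; exact lt_irrefl _ hij'
    · exact Nat.le_add_right _ _
    · exact Nat.le_add_right _ _

/-! ### Moving every point to the next sampled point of its strip -/

/-- The points in the strip of the position `p.1` (strips have width `w`) with values between
that of `p.1` and `p.2`. -/
def runSet (w : ℕ) (π : Equiv.Perm (Fin n)) (p : Fin n × Fin n) : Finset (Fin n) :=
  univ.filter fun i => (i : ℕ) / w = p.1 / w ∧ π p.1 ≤ π i ∧ π i ≤ p.2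

/-- The weight of the value `v`: the top value stands for the points that cannot be moved up. -/
noncomputable def valueWeight (v : Fin n) : ℝ := 1 + if (v : ℕ) + 1 = n then 2 * (n : ℝ) else 0

noncomputable def runWeight (π : Equiv.Perm (Fin n)) (p : Fin n × Fin n) : ℝ :=
  if π p.1 ≤ p.2 then valueWeight p.2 else 0

theorem one_le_valueWeight (v : Fin n) : 1 ≤ valueWeight v := by
  unfold valueWeight
  split_ifs <;> simp

theorem runWeight_nonneg (π : Equiv.Perm (Fin n)) (p : Fin n × Fin n) : 0 ≤ runWeight π p := by
  unfold runWeight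
  split_ifs
  · exact zero_le_one.trans (one_le_valueWeight _)
  · exact le_rfl

theorem sum_valueWeight_le : ∑ v : Fin n, valueWeight v ≤ 3 * n := by
  unfold valueWeight
  rw [Finset.sum_add_distrib]
  have h : ∑ v : Fin n, (if (v : ℕ) + 1 = n then 2 * (n : ℝ) else 0) ≤ 2 * n := by
    rcases Nat.eq_zero_or_pos n with rfl | hn
    · simp
    · rw [Finset.sum_eq_single (⟨n - 1, by omega⟩ : Fin n)]
      · split_ifs
        · exact le_rfl
        · positivity
      · intro v _ hv
        rw [if_neg fun e => hv (Fin.ext (by simp; omega))]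
      · simp
  simp only [sum_const, card_univ, Fintype.card_fin, nsmul_eq_mul, mul_one]
  linarith

theorem abs_sub_le_of_div_eq {a b w : ℕ} (hw : 0 < w) (h : a / w = b / w) :
    |(a : ℝ) - b| ≤ w := by
  have h1 := Nat.div_add_mod a w
  have h2 := Nat.div_add_mod b w
  have h3 := Nat.mod_lt a hw
  have h4 := Nat.mod_lt b hw
  rw [h] at h1
  have h5 : a ≤ b + w := by omega
  have h6 : b ≤ a + w := by omega
  have h5' : (a : ℝ) ≤ b + w := by exact_mod_cast h5
  have h6' : (b : ℝ) ≤ a + w := by exact_mod_cast h6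
  rw [abs_le]
  constructor <;> linarith

theorem exists_sampled_near (π : Equiv.Perm (Fin n)) {T : Finset (Fin n)} (hT : T.Nonempty)
    {w : ℕ} (hw : 0 < w) (i : Fin n) :
    ∃ s ∈ T, |((i : ℕ) : ℝ) - (s : ℕ)| + |((π i : ℕ) : ℝ) - (π s : ℕ)| ≤
      w + ∑ v, runWeight π (i, v) * if Disjoint (runSet w π (i, v)) T then (1 : ℝ) else 0 := by
  have hnn : ∀ v, 0 ≤ runWeight π (i, v) * if Disjoint (runSet w π (i, v)) T then (1 : ℝ) else 0 :=
    fun v => mul_nonneg (runWeight_nonneg _ _) (by split_ifs <;> simp)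
  by_cases hex : ∃ s ∈ T, (s : ℕ) / w = i / w ∧ π i ≤ π s
  · obtain ⟨s, hs, hmin⟩ := Finset.exists_min_image
      (T.filter fun s : Fin n => (s : ℕ) / w = i / w ∧ π i ≤ π s) π
      (by obtain ⟨s, hs⟩ := hex; exact ⟨s, by simpa using hs⟩)
    rw [mem_filter] at hs
    refine ⟨s, hs.1, add_le_add (abs_sub_le_of_div_eq hw hs.2.1.symm) ?_⟩
    have hle : ((π i : ℕ) : ℝ) ≤ (π s : ℕ) := Nat.cast_le.2 hs.2.2
    calc |((π i : ℕ) : ℝ) - (π s : ℕ)| = ∑ v ∈ Finset.Ico (π i) (π s), (1 : ℝ) := by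
          rw [abs_sub_comm, abs_of_nonneg (by linarith), Finset.sum_const, Fin.card_Ico,
            nsmul_eq_mul, mul_one, Nat.cast_sub hs.2.2]
      _ ≤ ∑ v ∈ Finset.Ico (π i) (π s), runWeight π (i, v) *
            if Disjoint (runSet w π (i, v)) T then (1 : ℝ) else 0 := by
          refine Finset.sum_le_sum fun v hv => ?_
          rw [Finset.mem_Ico] at hv
          rw [if_pos, mul_one, runWeight, if_pos hv.1]
          · exact one_le_valueWeight v
          · refine Finset.disjoint_left.2 fun x hx hxT => ?_
            simp only [runSet, mem_filter, mem_univ, true_and] at hx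
            have := hmin x (mem_filter.2 ⟨hxT, hx.1, hx.2.1⟩)
            exact absurd (hx.2.2.trans_lt hv.2) (not_lt.2 this)
      _ ≤ _ := Finset.sum_le_sum_of_subset_of_nonneg (Finset.subset_univ _) fun v _ _ => hnn v
  · push Not at hex
    obtain ⟨s, hs⟩ := hT
    have hn : 0 < n := i.pos
    set v : Fin n := ⟨n - 1, by omega⟩ with hv
    have hle : ∀ x : Fin n, x ≤ v := fun x => Fin.le_def.2 (by simp [hv]; omega)
    refine ⟨s, hs, le_trans ?_ (add_le_add_right
      (Finset.single_le_sum (fun v _ => hnn v) (mem_univ v)) _)⟩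
    rw [if_pos, mul_one, runWeight, if_pos (hle _), valueWeight, if_pos (by simp [hv]; omega)]
    · have hb : ∀ x y : Fin n, |((x : ℕ) : ℝ) - (y : ℕ)| ≤ n := by
        intro x y
        have h1 : ((x : ℕ) : ℝ) ≤ n := Nat.cast_le.2 x.2.le
        have h2 : ((y : ℕ) : ℝ) ≤ n := Nat.cast_le.2 y.2.le
        have h3 : (0 : ℝ) ≤ (x : ℕ) := Nat.cast_nonneg _
        have h4 : (0 : ℝ) ≤ (y : ℕ) := Nat.cast_nonneg _
        rw [abs_le]
        constructor <;> linarith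
      have := hb i s
      have := hb (π i) (π s)
      have : (0 : ℝ) ≤ w := Nat.cast_nonneg _
      linarith
    · refine Finset.disjoint_left.2 fun x hx hxT => ?_
      simp only [runSet, mem_filter, mem_univ, true_and] at hx
      exact absurd hx.2.1 (not_le.2 (hex x hxT hx.1))

theorem geom_sum_le_inv {y : ℝ} (hy0 : 0 ≤ y) (hy1 : y < 1) (m : ℕ) :
    ∑ r ∈ range m, y ^ r ≤ 1 / (1 - y) := by
  rw [le_div_iff₀ (by linarith), geom_sum_mul_neg]
  linarith [pow_nonneg hy0 m]

theorem sum_runWeight_le (w : ℕ) (π : Equiv.Perm (Fin n)) {y : ℝ} (hy0 : 0 ≤ y) (hy1 : y < 1)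
    (s : ℕ) : ∑ p : Fin n × Fin n with (p.1 : ℕ) / w = s, runWeight π p * y ^ #(runSet w π p) ≤
      3 * n * (1 / (1 - y)) := by
  have h1 : ∑ p : Fin n × Fin n with (p.1 : ℕ) / w = s, runWeight π p * y ^ #(runSet w π p) =
      ∑ v, valueWeight v * ∑ i ∈ univ.filter (fun i : Fin n => (i : ℕ) / w = s ∧ π i ≤ v), y ^ #(runSet w π (i, v)) := by
    rw [Finset.sum_filter, Fintype.sum_prod_type, Finset.sum_comm]
    refine Finset.sum_congr rfl fun v _ => ?_
    rw [Finset.mul_sum, Finset.sum_filter]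
    refine Finset.sum_congr rfl fun i _ => ?_
    by_cases h1 : (i : ℕ) / w = s <;> by_cases h2 : π i ≤ v <;> simp [h1, h2, runWeight]
  have h2 : ∀ v : Fin n, ∑ i ∈ univ.filter (fun i : Fin n => (i : ℕ) / w = s ∧ π i ≤ v), y ^ #(runSet w π (i, v)) ≤
      1 / (1 - y) := by
    intro v
    have hlt : ∀ i j : Fin n, (i : ℕ) / w = s ∧ π i ≤ v → (j : ℕ) / w = s ∧ π j ≤ v → π i < π j →
        #(runSet w π (j, v)) < #(runSet w π (i, v)) := by
      intro i j hi hj hij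
      refine Finset.card_lt_card (Finset.ssubset_iff_of_subset (fun x hx => ?_) |>.2 ⟨i, ?_, ?_⟩)
      · simp only [runSet, mem_filter, mem_univ, true_and] at hx ⊢
        exact ⟨hx.1.trans (hj.1.trans hi.1.symm), hij.le.trans hx.2.1, hx.2.2⟩
      · simp [runSet, hi.2]
      · simp [runSet, hij]
    have hinj : Set.InjOn (fun i => #(runSet w π (i, v)))
        (univ.filter fun i : Fin n => (i : ℕ) / w = s ∧ π i ≤ v : Finset (Fin n)) := by
      intro i hi j hj hij
      simp only [coe_filter, mem_univ, true_and, Set.mem_ofPred_eq] at hi hj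
      rcases lt_trichotomy (π i) (π j) with h | h | h
      · exact absurd hij (hlt i j hi hj h).ne'
      · exact π.injective h
      · exact absurd hij (hlt j i hj hi h).ne
    rw [← Finset.sum_image (f := fun r => y ^ r) hinj]
    refine le_trans (Finset.sum_le_sum_of_subset_of_nonneg (t := range (n + 1)) ?_
      fun r _ _ => pow_nonneg hy0 r) (geom_sum_le_inv hy0 hy1 _)
    intro r hr
    obtain ⟨i, _, rfl⟩ := Finset.mem_image.1 hr
    exact mem_range.2 (Nat.lt_succ_of_le ((Finset.card_le_univ _).trans_eq (Fintype.card_fin n)))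
  have hpos : 0 ≤ 1 / (1 - y) := by
    have : 0 < 1 - y := by linarith
    positivity
  calc _ = _ := h1
    _ ≤ ∑ v : Fin n, valueWeight v * (1 / (1 - y)) := Finset.sum_le_sum fun v _ =>
        mul_le_mul_of_nonneg_left (h2 v) (zero_le_one.trans (one_le_valueWeight v))
    _ ≤ _ := by
        rw [← Finset.sum_mul]
        exact mul_le_mul_of_nonneg_right sum_valueWeight_le hpos

/-- The cost of moving every point of `π` to the next sampled point of its strip. -/
noncomputable def transportCost (w : ℕ) (π : Equiv.Perm (Fin n)) (T : Finset (Fin n)) : ℝ :=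
  n * w + ∑ p, runWeight π p * if Disjoint (runSet w π p) T then (1 : ℝ) else 0

theorem exists_assignment (π : Equiv.Perm (Fin n)) (hM : 0 < M) (S : Sample n M)
    {w : ℕ} (hw : 0 < w) :
    ∃ a : Fin n → Fin M, ∑ i : Fin n,
      (|((i : ℕ) : ℝ) - ((S.1.orderEmbOfFin S.2 (a i) : Fin n) : ℕ)| +
        |((π i : ℕ) : ℝ) - (π (S.1.orderEmbOfFin S.2 (a i)) : ℕ)|) ≤ transportCost w π S.1 := by
  have hT : S.1.Nonempty := Finset.card_pos.1 (S.2.symm ▸ hM)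
  choose s hs hle using exists_sampled_near π hT hw
  have hex : ∀ i, ∃ a : Fin M, S.1.orderEmbOfFin S.2 a = s i := fun i => by
    have : s i ∈ Set.range (S.1.orderEmbOfFin S.2) := by
      rw [Finset.range_orderEmbOfFin]; exact hs i
    exact this
  choose a ha using hex
  refine ⟨a, ?_⟩
  simp only [ha]
  refine (Finset.sum_le_sum fun i _ => hle i).trans (le_of_eq ?_)
  rw [Finset.sum_add_distrib, transportCost, Fintype.sum_prod_type]
  simp

theorem le_of_mul_sq_le {B ε n k m N : ℝ} (hε : 0 < ε) (hN : 0 ≤ N) (hn : 0 < n) (hk : 0 < k)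
    (hm : 0 < m) (hB : 0 ≤ B) (hεm : 20000 ≤ ε ^ 2 * m) (hkm : k * k ≤ m) (hεk : 100 ≤ ε * k)
    (h : B * (ε * n ^ 2 / 10) ^ 2 ≤ k * (6 * n ^ 2 / m) ^ 2 * N) : B ≤ ε / 6 * N := by
  have h1 : B * (ε ^ 2 * m) * m ≤ 3600 * k * N := by
    have h2 : k * (6 * n ^ 2 / m) ^ 2 * N = (36 * k * N / m ^ 2) * n ^ 4 := by
      ring
    have h3 : B * (ε * n ^ 2 / 10) ^ 2 = (B * ε ^ 2 / 100) * n ^ 4 := by ring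
    rw [h2, h3] at h
    have h4 := le_of_mul_le_mul_right h (by positivity)
    rw [div_le_div_iff₀ (by norm_num) (by positivity)] at h4
    calc B * (ε ^ 2 * m) * m = B * ε ^ 2 * m ^ 2 := by ring
      _ ≤ _ := h4
      _ = _ := by ring
  have h2 : B * 20000 * (k * k) ≤ 3600 * k * N := by
    refine le_trans ?_ h1
    gcongr
  have h3 : B * 20000 * k ≤ 3600 * N := by
    refine le_of_mul_le_mul_right (a := k) ?_ hk
    linarith
  have h4 := mul_le_mul_of_nonneg_left h3 hε.le
  have h5 := mul_le_mul_of_nonneg_left hεk (mul_nonneg hB (by norm_num : (0 : ℝ) ≤ 20000))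
  have hN0 : 0 ≤ ε * N := by positivity
  linarith

theorem card_samples_transportCost_ge {ε : ℝ} (hε : 0 < ε) (hε2 : ε ≤ 2)
    (hM : 20000 ≤ ε ^ 2 * M) (hMn : M ≤ n) (π : Equiv.Perm (Fin n)) :
    (#{S : Sample n M | ε * n * (n - 1) / 4 ≤ transportCost (n / Nat.sqrt M + 1) π S.1} : ℝ) ≤
      ε / 6 * n.choose M := by
  set k := Nat.sqrt M with hk
  set w := n / k + 1 with hw
  have hMreal : (5000 : ℝ) ≤ M := by
    have h4 : ε ^ 2 ≤ 4 := by nlinarith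
    have := mul_le_mul_of_nonneg_right h4 (Nat.cast_nonneg (α := ℝ) M)
    linarith
  have hM0 : (0 : ℝ) < M := by linarith
  have hnM : (M : ℝ) ≤ n := by exact_mod_cast hMn
  have hn0 : (0 : ℝ) < n := by linarith
  have hkM : (k : ℝ) * k ≤ M := by exact_mod_cast Nat.sqrt_le M
  have hMk : (M : ℝ) ≤ k * k + k + k := by exact_mod_cast Nat.sqrt_le_add M
  have hk0 : 0 < k := Nat.sqrt_pos.2 (by exact_mod_cast hM0)
  have hk1 : (1 : ℝ) ≤ k := by exact_mod_cast hk0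
  have hεk : 100 ≤ ε * k := by
    by_contra! hlt
    have h1 : ε ^ 2 * M ≤ (ε * k) ^ 2 + 2 * ε * (ε * k) := by
      nlinarith [mul_le_mul_of_nonneg_left hMk (sq_nonneg ε)]
    have h0 : 0 ≤ ε * k := by positivity
    nlinarith
  have hcover : ∀ i : Fin n, (i : ℕ) / w < k := by
    intro i
    rw [Nat.div_lt_iff_lt_mul (Nat.succ_pos _)]
    have := Nat.lt_mul_div_succ n hk0
    have := i.2
    calc (i : ℕ) < n := i.2
      _ ≤ k * w := by rw [hw]; omega
  set q : ℝ := 1 - M / n with hq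
  have hMn1 : (M : ℝ) / n ≤ 1 := by rw [div_le_one hn0]; exact hnM
  have hMn0 : 0 < (M : ℝ) / n := by positivity
  have hq0 : 0 ≤ q := by linarith
  set y := Real.sqrt q with hy
  have hy0 : 0 ≤ y := Real.sqrt_nonneg _
  have hyq : y ^ 2 = q := Real.sq_sqrt hq0
  have hy1 : y < 1 := by nlinarith
  have hinv : 1 / (1 - y) ≤ 2 * n / M := by
    rw [div_le_div_iff₀ (by linarith) hM0]
    have h1 : M / n * n = (M : ℝ) := by field_simp
    have h2 : (M : ℝ) / n ≤ 2 * (1 - y) := by nlinarith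
    nlinarith
  have hCheb := card_samples_missed_ge hMn (runWeight π) (runWeight_nonneg π) (runSet w π)
    (fun p => (⟨(p.1 : ℕ) / w, hcover p.1⟩ : Fin k))
    (fun p p' hpp => Finset.disjoint_left.2 fun x hx hx' => hpp (by
      simp only [runSet, mem_filter, mem_univ, true_and] at hx hx'
      exact Fin.ext (hx.1.symm.trans hx'.1)))
    y hy0 hy1.le (by rw [hyq, missProb_one hMn (by exact_mod_cast hn0)]) (6 * n ^ 2 / M)
    (fun s => by
      have := sum_runWeight_le w π hy0 hy1 s
      simp only [Fin.ext_iff]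
      refine this.trans ?_
      calc 3 * n * (1 / (1 - y)) ≤ 3 * (n : ℝ) * (2 * n / M) :=
            mul_le_mul_of_nonneg_left hinv (by positivity)
        _ = _ := by ring)
    (ε * n ^ 2 / 10) (by positivity)
  rw [Fintype.card_fin] at hCheb
  set B : ℝ := (#{S : Sample n M | ε * n * (n - 1) / 4 ≤ transportCost w π S.1} : ℝ) with hB
  have hB0 : 0 ≤ B := Nat.cast_nonneg _
  have hmono : B ≤ (#{S : Sample n M | k * (6 * (n : ℝ) ^ 2 / M) + ε * n ^ 2 / 10 ≤
      ∑ a, runWeight π a * if Disjoint (runSet w π a) S.1 then (1 : ℝ) else 0} : ℝ) := by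
    rw [hB, Nat.cast_le]
    refine Finset.card_le_card fun S hS => ?_
    simp only [mem_filter, mem_univ, true_and] at hS ⊢
    have hwle : (w : ℝ) ≤ n / k + 1 := by
      rw [hw]; push_cast
      exact add_le_add_left Nat.cast_div_le _
    have h1 : n * (w : ℝ) ≤ 2 * n ^ 2 / k := by
      have : (1 : ℝ) ≤ n / k := by rw [le_div_iff₀ (by linarith)]; nlinarith
      calc n * (w : ℝ) ≤ n * (n / k + n / k) := by gcongr; linarith
        _ = _ := by ring
    have h2 : k * (6 * (n : ℝ) ^ 2 / M) ≤ 6 * n ^ 2 / k := by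
      rw [← mul_div_assoc, div_le_div_iff₀ hM0 (by linarith)]
      have := mul_le_mul_of_nonneg_left hkM (show (0 : ℝ) ≤ 6 * n ^ 2 by positivity)
      linarith
    have h3 : 8 * (n : ℝ) ^ 2 / k ≤ 8 / 100 * ε * n ^ 2 := by
      rw [div_le_iff₀ (by linarith)]
      have := mul_le_mul_of_nonneg_left hεk (show (0 : ℝ) ≤ 8 / 100 * n ^ 2 by positivity)
      linarith
    have h4 : 18 / 100 * ε * (n : ℝ) ^ 2 ≤ ε * n * (n - 1) / 4 := by
      have : (0 : ℝ) ≤ ε * n * (7 / 100 * n - 1 / 4) := by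
        apply mul_nonneg (by positivity); linarith
      linarith
    have h5 : 8 * (n : ℝ) ^ 2 / k = 2 * n ^ 2 / k + 6 * n ^ 2 / k := by ring
    unfold transportCost at hS
    linarith
  exact le_of_mul_sq_le hε (by positivity) hn0 (by linarith) hM0 hB0 hM hkM hεk
    ((mul_le_mul_of_nonneg_right hmono (by positivity)).trans hCheb)

end Closeness

/-! ### Samples of a long member of the property can be blown up -/

section BlowUp

variable {n M : ℕ}

theorem exists_uniformBlowUp_mem {P : PermProperty} (hP : Hereditary P) {π : Equiv.Perm (Fin n)}
    (hπ : π ∈ P n) {m k : ℕ} (α : Equiv.Perm (Fin m)) (hk : 0 < k) (B : Fin m → Finset (Fin n))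
    (hB : ∀ j, k ≤ #(B j)) (hpos : ∀ j l, j < l → ∀ x ∈ B j, ∀ y ∈ B l, x < y)
    (hval : ∀ j l, α j < α l → ∀ x ∈ B j, ∀ y ∈ B l, π x < π y) :
    ∃ β ∈ P (m * k), IsUniformBlowUp k α β := by
  choose C hCB hC using fun j => Finset.exists_subset_card_eq (hB j)
  set f : Fin (m * k) → Fin n := fun i => (C i.divNat).orderEmbOfFin (hC _) i.modNat with hf
  have hmem : ∀ i, f i ∈ B i.divNat := fun i => hCB _ (Finset.orderEmbOfFin_mem _ _ _)
  have hmono : StrictMono f := by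
    intro x y hxy
    have hxy' : (x : ℕ) < y := hxy
    rcases lt_trichotomy x.divNat y.divNat with h | h | h
    · exact hpos _ _ h _ (hmem x) _ (hmem y)
    · have h1 : x.modNat < y.modNat := by
        have hd : (x : ℕ) / k = y / k := congrArg Fin.val h
        have h2 := Nat.div_add_mod (x : ℕ) k
        have h3 := Nat.div_add_mod (y : ℕ) k
        rw [hd] at h2
        exact Fin.lt_def.2 (show (x : ℕ) % k < y % k by omega)
      simp only [hf]
      rw [h]
      exact (OrderEmbedding.lt_iff_lt _).2 h1
    · have : (y : ℕ) / k < x / k := h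
      exact absurd (Nat.div_le_div_right (c := k) hxy'.le) (not_le.2 this)
  obtain ⟨β, hβ⟩ := exists_orderType (fun i => π (f i)) (π.injective.comp hmono.injective)
  refine ⟨β, hP _ _ β π hπ ⟨OrderEmbedding.ofStrictMono f hmono, fun j l => (hβ j l).symm⟩,
    fun j => j * k, ⟨fun j l h => Nat.mul_lt_mul_of_pos_right h hk, by simp, by simp, ?_⟩,
    fun j => by simp [Nat.succ_mul]⟩
  have hdiv : ∀ (i : Fin (m * k)) (j : Fin m), ((j.castSucc : Fin (m + 1)) : ℕ) * k ≤ i →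
      (i : ℕ) < (j.succ : Fin (m + 1)) * k → i.divNat = j := by
    intro i j h1 h2
    refine Fin.ext (show (i : ℕ) / k = j from ?_)
    exact Nat.div_eq_of_lt_le (by simpa using h1) (by simpa using h2)
  intro i₁ i₂ j₁ j₂ hj h1 h1' h2 h2'
  rw [hβ]
  have hm1 := hmem i₁
  have hm2 := hmem i₂
  rw [hdiv i₁ j₁ h1 h1'] at hm1
  rw [hdiv i₂ j₂ h2 h2'] at hm2
  refine ⟨fun h => ?_, fun h => hval _ _ h _ hm2 _ hm1⟩
  by_contra! hcon
  exact absurd (hval _ _ (lt_of_le_of_ne hcon fun e => hj (α.injective e)) _ hm1 _ hm2)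
    (not_lt.2 h.le)

/-- The number of points in the `t`-th strip of width `w` with value less than `x`. -/
def stripRank (w t : ℕ) (π : Equiv.Perm (Fin n)) (x : Fin n) : ℕ :=
  #{i : Fin n | (i : ℕ) / w = t ∧ π i < x}

/-- When the points of each strip are sorted by value and cut into groups of size `K`,
the group of the position `i`. -/
def stripGroup (w K : ℕ) (π : Equiv.Perm (Fin n)) (i : Fin n) : Finset (Fin n) :=
  {j : Fin n | (j : ℕ) / w = i / w ∧
    stripRank w (i / w) π (π j) / K = stripRank w (i / w) π (π i) / K}

theorem stripRank_mono (w t : ℕ) (π : Equiv.Perm (Fin n)) : Monotone (stripRank w t π) := by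
  intro x y hxy
  refine Finset.card_le_card fun i hi => ?_
  simp only [mem_filter, mem_univ, true_and] at hi ⊢
  exact ⟨hi.1, hi.2.trans_le hxy⟩

theorem stripRank_lt (w : ℕ) {t : ℕ} (π : Equiv.Perm (Fin n)) {i : Fin n} (hi : (i : ℕ) / w = t)
    {y : Fin n} (h : π i < y) : stripRank w t π (π i) < stripRank w t π y := by
  refine Finset.card_lt_card ((Finset.ssubset_iff_of_subset fun x hx => ?_).2 ⟨i, ?_, ?_⟩)
  · simp only [mem_filter, mem_univ, true_and] at hx ⊢
    exact ⟨hx.1, hx.2.trans h⟩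
  · simp [hi, h]
  · simp

theorem stripRank_injOn (w t : ℕ) (π : Equiv.Perm (Fin n)) :
    Set.InjOn (fun i => stripRank w t π (π i))
      (({i : Fin n | (i : ℕ) / w = t} : Finset (Fin n)) : Set (Fin n)) := by
  intro i hi j hj hij
  simp only [coe_filter, mem_univ, true_and, Set.mem_ofPred_eq] at hi hj
  rcases lt_trichotomy (π i) (π j) with h | h | h
  · exact absurd hij (stripRank_lt w π hi h).ne
  · exact π.injective h
  · exact absurd hij (stripRank_lt w π hj h).ne'

theorem image_stripRank (w t : ℕ) (π : Equiv.Perm (Fin n)) :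
    Finset.image (fun i => stripRank w t π (π i)) {i : Fin n | (i : ℕ) / w = t} =
      range #{i : Fin n | (i : ℕ) / w = t} := by
  refine Finset.eq_of_subset_of_card_le (fun r hr => ?_) ?_
  · obtain ⟨i, hi, rfl⟩ := Finset.mem_image.1 hr
    simp only [mem_filter, mem_univ, true_and] at hi
    refine mem_range.2 (Finset.card_lt_card ((Finset.ssubset_iff_of_subset fun x hx => ?_).2
      ⟨i, by simp [hi], by simp⟩))
    simp only [mem_filter, mem_univ, true_and] at hx ⊢
    exact hx.1
  · rw [card_range, Finset.card_image_of_injOn (stripRank_injOn w t π)]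

theorem card_stripRank_div_eq_le (w t : ℕ) {K : ℕ} (hK : 0 < K) (π : Equiv.Perm (Fin n)) (q : ℕ) :
    #{j : Fin n | (j : ℕ) / w = t ∧ stripRank w t π (π j) / K = q} ≤ K := by
  have h := Finset.card_le_card_of_injOn (t := Finset.Ico (q * K) (q * K + K))
    (s := {j : Fin n | (j : ℕ) / w = t ∧ stripRank w t π (π j) / K = q})
    (fun j => stripRank w t π (π j)) (fun j hj => ?_)
    ((stripRank_injOn w t π).mono fun j hj => ?_)
  · simpa using h
  · simp only [coe_filter, mem_univ, true_and, Set.mem_ofPred_eq] at hj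
    have h1 := Nat.div_add_mod (stripRank w t π (π j)) K
    have h2 := Nat.mod_lt (stripRank w t π (π j)) hK
    rw [hj.2, mul_comm] at h1
    simp only [coe_Ico, Set.mem_Ico]
    omega
  · simp only [coe_filter, mem_univ, true_and, Set.mem_ofPred_eq] at hj ⊢
    exact hj.1

theorem stripRank_div_eq_of_card_lt {w K : ℕ} (hK : 0 < K) (π : Equiv.Perm (Fin n)) {i : Fin n}
    (hi : #(stripGroup w K π i) < K) :
    stripRank w (i / w) π (π i) / K = #{j : Fin n | (j : ℕ) / w = i / w} / K := by
  set t := (i : ℕ) / w with ht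
  have hlt : stripRank w t π (π i) < #{j : Fin n | (j : ℕ) / w = t} := by
    rw [← mem_range, ← image_stripRank w t π]
    exact Finset.mem_image_of_mem _ (by simp [ht])
  refine le_antisymm (Nat.div_le_div_right hlt.le) ?_
  by_contra! hcon
  set q := stripRank w t π (π i) / K with hq
  have hle : (q + 1) * K ≤ #{j : Fin n | (j : ℕ) / w = t} := (Nat.le_div_iff_mul_le hK).1 hcon
  have hsub : Finset.Ico (q * K) (q * K + K) ⊆
      (stripGroup w K π i).image fun j => stripRank w t π (π j) := by
    intro r hr
    rw [Finset.mem_Ico] at hr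
    have hr' : r ∈ range #{j : Fin n | (j : ℕ) / w = t} := mem_range.2 (by
      rw [Nat.succ_mul] at hle; omega)
    rw [← image_stripRank w t π] at hr'
    obtain ⟨j, hj, rfl⟩ := Finset.mem_image.1 hr'
    refine Finset.mem_image_of_mem _ ?_
    simp only [stripGroup, mem_filter, mem_univ, true_and] at hj ⊢
    refine ⟨hj, (Nat.div_eq_of_lt_le hr.1 (by rw [Nat.succ_mul]; exact hr.2))⟩
  have := (Finset.card_le_card hsub).trans Finset.card_image_le
  rw [Nat.card_Ico] at this
  omega

theorem card_stripGroup_lt_le {w K : ℕ} (hK : 0 < K) (π : Equiv.Perm (Fin n)) :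
    #{i : Fin n | #(stripGroup w K π i) < K} ≤ (n / w + 1) * K := by
  have hsub : ({i : Fin n | #(stripGroup w K π i) < K} : Finset (Fin n)) ⊆
      (range (n / w + 1)).biUnion fun t => {j : Fin n | (j : ℕ) / w = t ∧
        stripRank w t π (π j) / K = #{j : Fin n | (j : ℕ) / w = t} / K} := by
    intro i hi
    simp only [mem_filter, mem_univ, true_and] at hi
    simp only [mem_biUnion, mem_range, mem_filter, mem_univ, true_and]
    exact ⟨i / w, Nat.lt_succ_of_le (Nat.div_le_div_right i.2.le), rfl,
      stripRank_div_eq_of_card_lt hK π hi⟩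
  refine (Finset.card_le_card hsub).trans ((Finset.card_biUnion_le_card_mul _ _ K
    fun t _ => card_stripRank_div_eq_le w t hK π _).trans_eq (by rw [card_range]))

/-- The pairs of positions that lie in the same strip, or such that the value of `low p.1`
falls into the group of `p.2`. -/
def crossingPairs (w K : ℕ) (π : Equiv.Perm (Fin n)) (low : Fin n → Fin n) :
    Finset (Fin n × Fin n) :=
  {p : Fin n × Fin n | p.1 ≠ p.2 ∧ ((p.2 : ℕ) / w = p.1 / w ∨
    stripRank w (p.2 / w) π (π p.2) / K = stripRank w (p.2 / w) π (π (low p.1)) / K)}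

theorem card_strip_le {w : ℕ} (hw : 0 < w) (t : ℕ) : #{j : Fin n | (j : ℕ) / w = t} ≤ w := by
  have h := Finset.card_le_card_of_injOn (t := Finset.Ico (t * w) (t * w + w))
    (s := {j : Fin n | (j : ℕ) / w = t}) (fun j => (j : ℕ)) (fun j hj => ?_)
    (fun i _ j _ h => Fin.ext h)
  · simpa using h
  · simp only [coe_filter, mem_univ, true_and, Set.mem_ofPred_eq] at hj
    have h1 := Nat.div_add_mod (j : ℕ) w
    have h2 := Nat.mod_lt (j : ℕ) hw
    rw [hj, mul_comm] at h1
    simp only [coe_Ico, Set.mem_Ico]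
    omega

theorem card_crossingPairs_le {w K : ℕ} (hw : 0 < w) (hK : 0 < K) (π : Equiv.Perm (Fin n))
    (low : Fin n → Fin n) :
    #(crossingPairs w K π low) ≤ n * (w + (n / w + 1) * K) := by
  have hsub : crossingPairs w K π low ⊆ univ.biUnion fun i : Fin n =>
      (({j : Fin n | (j : ℕ) / w = i / w} : Finset (Fin n)) ∪
        (range (n / w + 1)).biUnion fun t => {j : Fin n | (j : ℕ) / w = t ∧
          stripRank w t π (π j) / K = stripRank w t π (π (low i)) / K}).image fun j => (i, j) := by
    rintro ⟨i, j⟩ hij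
    simp only [crossingPairs, mem_filter, mem_univ, true_and] at hij
    refine mem_biUnion.2 ⟨i, mem_univ i, mem_image_of_mem _ ?_⟩
    rw [mem_union]
    rcases hij.2 with h | h
    · exact Or.inl (by simpa using h)
    · refine Or.inr (mem_biUnion.2 ⟨j / w, mem_range.2
        (Nat.lt_succ_of_le (Nat.div_le_div_right j.2.le)), ?_⟩)
      simpa using h
  refine (Finset.card_le_card hsub).trans ((Finset.card_biUnion_le_card_mul _ _ _
    fun i _ => ?_).trans_eq (by rw [card_univ, Fintype.card_fin]))
  refine Finset.card_image_le.trans ((Finset.card_union_le _ _).trans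
    (add_le_add (card_strip_le hw _) ?_))
  exact (Finset.card_biUnion_le_card_mul _ _ K
    fun t _ => card_stripRank_div_eq_le w t hK π _).trans_eq (by rw [card_range])

theorem self_mem_stripGroup (w K : ℕ) (π : Equiv.Perm (Fin n)) (i : Fin n) :
    i ∈ stripGroup w K π i := by simp [stripGroup]

theorem lt_of_low_lt {w K : ℕ} {π : Equiv.Perm (Fin n)} {low : Fin n → Fin n} {i j : Fin n}
    (hlow : low i ∈ stripGroup w K π i)
    (hji : (j, i) ∉ crossingPairs w K π low) (hne : j ≠ i)
    (h : π (low i) < π (low j)) {x : Fin n} (hx : x ∈ stripGroup w K π i) :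
    π x < π (low j) := by
  by_contra! hcon
  refine hji ?_
  simp only [crossingPairs, stripGroup, mem_filter, mem_univ, true_and] at hlow hx ⊢
  refine ⟨hne, Or.inr (le_antisymm ?_ ?_)⟩
  · rw [← hlow.2]
    exact Nat.div_le_div_right (stripRank_mono w _ π h.le)
  · rw [← hx.2]
    exact Nat.div_le_div_right (stripRank_mono w _ π hcon)

theorem exists_uniformBlowUp_induced {P : PermProperty} (hP : Hereditary P)
    {π : Equiv.Perm (Fin n)} (hπ : π ∈ P n) {w K k : ℕ} (hk : 0 < k) (hkK : k ≤ K)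
    {low : Fin n → Fin n} (hlow : ∀ i, low i ∈ stripGroup w K π i)
    (hlow' : ∀ i, ∀ x ∈ stripGroup w K π i, π (low i) ≤ π x) (S : Sample n M)
    (hfull : ∀ i ∈ S.1, K ≤ #(stripGroup w K π i))
    (hpairs : ∀ i ∈ S.1, ∀ j ∈ S.1, (i, j) ∉ crossingPairs w K π low) :
    ∃ β ∈ P (M * k), IsUniformBlowUp k (induced π S) β := by
  set e := S.1.orderEmbOfFin S.2 with he
  have hmem : ∀ j, e j ∈ S.1 := fun j => Finset.orderEmbOfFin_mem _ _ _
  have hstrip : ∀ {i j : Fin n}, i ∈ S.1 → j ∈ S.1 → i ≠ j → (i : ℕ) / w ≠ j / w := by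
    intro i j hi hj hij h
    exact hpairs i hi j hj (by simp [crossingPairs, hij, h])
  have hin : ∀ {i x : Fin n}, x ∈ stripGroup w K π i → (x : ℕ) / w = i / w := by
    intro i x hx
    simp only [stripGroup, mem_filter, mem_univ, true_and] at hx
    exact hx.1
  refine exists_uniformBlowUp_mem hP hπ _ hk (fun j => stripGroup w K π (e j))
    (fun j => hkK.trans (hfull _ (hmem j))) ?_ ?_
  · intro j l hjl x hx y hy
    have hlt : e j < e l := (OrderEmbedding.lt_iff_lt _).2 hjl
    have h1 : (e j : ℕ) / w < e l / w := lt_of_le_of_ne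
      (Nat.div_le_div_right (Fin.lt_def.1 hlt).le) (hstrip (hmem j) (hmem l) hlt.ne)
    rw [← hin hx, ← hin hy] at h1
    by_contra! hcon
    exact absurd (Nat.div_le_div_right (c := w) (Fin.le_def.1 hcon)) (not_le.2 h1)
  · intro j l hjl x hx y hy
    rw [induced_lt_iff] at hjl
    have hne : e j ≠ e l := fun h => hjl.ne (congrArg π h)
    rcases lt_trichotomy (π (low (e j))) (π (low (e l))) with h | h | h
    · exact (lt_of_low_lt (hlow _) (hpairs _ (hmem l) _ (hmem j)) hne.symm h hx).trans_le
        (hlow' _ y hy)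
    · have h' := π.injective h
      refine absurd ?_ (hstrip (hmem j) (hmem l) hne)
      rw [← hin (hlow (e j)), h', hin (hlow (e l))]
    · have h1 := lt_of_low_lt (hlow _) (hpairs _ (hmem j) _ (hmem l)) hne h
        (self_mem_stripGroup w K π (e l))
      exact absurd (h1.trans_le (hlow' _ _ (self_mem_stripGroup w K π (e j))))
        (not_lt.2 hjl.le)

theorem card_samples_exists_le (h : M ≤ n) (hn : 0 < n) (D : Finset (Fin n))
    (E : Finset (Fin n × Fin n)) (hE : ∀ p ∈ E, p.1 ≠ p.2) :
    (#{S : Sample n M | (∃ i ∈ S.1, i ∈ D) ∨ ∃ i ∈ S.1, ∃ j ∈ S.1, (i, j) ∈ E} : ℝ) ≤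
      (#D * (M / n) + #E * (M / n) ^ 2) * n.choose M := by
  have hsub : ({S : Sample n M | (∃ i ∈ S.1, i ∈ D) ∨ ∃ i ∈ S.1, ∃ j ∈ S.1, (i, j) ∈ E} :
      Finset (Sample n M)) ⊆ (D.biUnion fun i => {S : Sample n M | i ∈ S.1}) ∪
        E.biUnion fun p => {S : Sample n M | p.1 ∈ S.1 ∧ p.2 ∈ S.1} := by
    intro S hS
    simp only [mem_filter, mem_univ, true_and, mem_union, mem_biUnion] at hS ⊢
    rcases hS with ⟨i, hi, hiD⟩ | ⟨i, hi, j, hj, hij⟩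
    · exact Or.inl ⟨i, hiD, hi⟩
    · exact Or.inr ⟨(i, j), hij, hi, hj⟩
  have h1 := (Finset.card_le_card hsub).trans ((Finset.card_union_le _ _).trans
    (add_le_add Finset.card_biUnion_le Finset.card_biUnion_le))
  have h2 : (#{S : Sample n M | (∃ i ∈ S.1, i ∈ D) ∨ ∃ i ∈ S.1, ∃ j ∈ S.1, (i, j) ∈ E} : ℝ) ≤
      ∑ i ∈ D, (#{S : Sample n M | i ∈ S.1} : ℝ) +
        ∑ p ∈ E, (#{S : Sample n M | p.1 ∈ S.1 ∧ p.2 ∈ S.1} : ℝ) := by exact_mod_cast h1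
  refine h2.trans ((add_le_add (Finset.sum_le_sum fun i _ => (card_samples_mem h hn i).le)
    (Finset.sum_le_sum fun p hp => card_samples_mem_mem_le h hn (hE p hp))).trans_eq ?_)
  rw [Finset.sum_const, Finset.sum_const, nsmul_eq_mul, nsmul_eq_mul]
  ring

open Classical in
theorem card_samples_no_blowUp_le {P : PermProperty} (hP : Hereditary P) {ε : ℝ} (hε : 0 < ε)
    (hε2 : ε ≤ 2) (hM : 20000 ≤ ε ^ 2 * M) (hMn : M ≤ n) {K : ℕ} (hK : 0 < K)
    (hn : 32 * (M : ℝ) ^ 5 * K ≤ n * ε ^ 3) {π : Equiv.Perm (Fin n)} (hπ : π ∈ P n) :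
    (#{S : Sample n M | ∃ k, 0 < k ∧ k ≤ K ∧ ∀ (N : ℕ) (β : Equiv.Perm (Fin N)),
      IsUniformBlowUp k (induced π S) β → β ∉ P N} : ℝ) ≤ ε / 6 * n.choose M := by
  have hMreal : (5000 : ℝ) ≤ M := by
    have h4 : ε ^ 2 ≤ 4 := by nlinarith
    have := mul_le_mul_of_nonneg_right h4 (Nat.cast_nonneg (α := ℝ) M)
    linarith
  have hM0 : (0 : ℝ) < M := by linarith
  have hM0' : 0 < M := by exact_mod_cast hM0
  have hnM : (M : ℝ) ≤ n := by exact_mod_cast hMn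
  have hn0 : (0 : ℝ) < n := by linarith
  have hK1 : (1 : ℝ) ≤ K := by exact_mod_cast hK
  have hε3 : ε ^ 3 ≤ 4 * ε := by nlinarith [mul_pos hε hε]
  set w := K * M ^ 3 with hw
  have hw0 : 0 < w := by positivity
  have hwR : (w : ℝ) = K * M ^ 3 := by rw [hw]; push_cast; ring
  have hexlow : ∀ i : Fin n, ∃ l ∈ stripGroup w K π i, ∀ x ∈ stripGroup w K π i, π l ≤ π x :=
    fun i => Finset.exists_min_image _ π ⟨i, self_mem_stripGroup w K π i⟩
  choose low hlow hlow' using hexlow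
  have hbound := card_samples_exists_le hMn (by exact_mod_cast hn0)
    {i : Fin n | #(stripGroup w K π i) < K} (crossingPairs w K π low)
    (fun p hp => (mem_filter.1 hp).2.1)
  have hsub : (#{S : Sample n M | ∃ k, 0 < k ∧ k ≤ K ∧ ∀ (N : ℕ) (β : Equiv.Perm (Fin N)),
      IsUniformBlowUp k (induced π S) β → β ∉ P N} : ℝ) ≤
      (#{S : Sample n M | (∃ i ∈ S.1, i ∈ ({i : Fin n | #(stripGroup w K π i) < K} : Finset (Fin n))) ∨
        ∃ i ∈ S.1, ∃ j ∈ S.1, (i, j) ∈ crossingPairs w K π low} : ℝ) := by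
    rw [Nat.cast_le]
    refine Finset.card_le_card fun S hS => ?_
    simp only [mem_filter, mem_univ, true_and] at hS ⊢
    by_contra! hcon
    obtain ⟨k, hk, hkK, hno⟩ := hS
    obtain ⟨β, hβ, hbl⟩ := exists_uniformBlowUp_induced hP hπ hk hkK hlow hlow' S
      hcon.1 hcon.2
    exact hno _ β hbl hβ
  refine hsub.trans (hbound.trans (mul_le_mul_of_nonneg_right ?_ (by positivity)))
  have hwn : (w : ℝ) ≤ n := by
    rw [hwR]
    have h1 : (K : ℝ) * M ^ 3 ≤ K * M ^ 5 :=
      mul_le_mul_of_nonneg_left (pow_le_pow_right₀ (by linarith) (by norm_num)) (by linarith)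
    have h2 : (n : ℝ) * ε ^ 3 ≤ n * 8 := mul_le_mul_of_nonneg_left (by linarith) hn0.le
    have h3 : (0 : ℝ) ≤ K * M ^ 5 := by positivity
    linarith
  have hgK : (((n / w + 1) * K : ℕ) : ℝ) ≤ 2 * n / M ^ 3 := by
    have hwpos : (0 : ℝ) < w := by exact_mod_cast hw0
    have h1 : ((n / w + 1 : ℕ) : ℝ) ≤ 2 * n / w := by
      have h2 : (1 : ℝ) ≤ n / w := by rwa [le_div_iff₀ hwpos, one_mul]
      have h3 : ((n / w : ℕ) : ℝ) ≤ n / w := Nat.cast_div_le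
      push_cast
      have h4 : 2 * (n : ℝ) / w = n / w + n / w := by ring
      linarith
    calc (((n / w + 1) * K : ℕ) : ℝ) = ((n / w + 1 : ℕ) : ℝ) * K := by push_cast; ring
      _ ≤ 2 * n / w * K := mul_le_mul_of_nonneg_right h1 (by linarith)
      _ = _ := by rw [hwR]; field_simp
  have hD : (#{i : Fin n | #(stripGroup w K π i) < K} : ℝ) ≤ 2 * n / M ^ 3 :=
    le_trans (by exact_mod_cast card_stripGroup_lt_le hK π) hgK
  have hE : (#(crossingPairs w K π low) : ℝ) ≤ n * (w + 2 * n / M ^ 3) := by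
    have : (#(crossingPairs w K π low) : ℝ) ≤ n * (w + ((n / w + 1) * K : ℕ)) := by
      exact_mod_cast card_crossingPairs_le hw0 hK π low
    exact this.trans (mul_le_mul_of_nonneg_left (by linarith) hn0.le)
  calc _ ≤ 2 * (n : ℝ) / M ^ 3 * (M / n) + n * (w + 2 * n / M ^ 3) * (M / n) ^ 2 := by gcongr
    _ = K * M ^ 5 / n + 2 / M + 2 / M ^ 2 := by rw [hwR]; field_simp; ring
    _ ≤ ε ^ 3 / 32 + 2 / M + 2 / M := by
        have h1 : (K : ℝ) * M ^ 5 / n ≤ ε ^ 3 / 32 := by rw [div_le_iff₀ hn0]; linarith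
        have h2 : 2 / (M : ℝ) ^ 2 ≤ 2 / M :=
          div_le_div_of_nonneg_left (by norm_num) hM0 (by nlinarith)
        linarith
    _ ≤ ε / 6 := by
        have h1 : 2 / (M : ℝ) ≤ ε ^ 2 / 10000 := by
          rw [div_le_iff₀ hM0]; linarith
        nlinarith

end BlowUp

/-! ### The tester -/

section Tester

variable {n M : ℕ}

open Classical in
theorem le_sampleProb (hMn : M ≤ n) (π : Equiv.Perm (Fin n)) (A : Set (Equiv.Perm (Fin M)))
    {δ : ℝ} (h : (#{S : Sample n M | induced π S ∉ A} : ℝ) ≤ δ * n.choose M) :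
    1 - δ ≤ sampleProb π A := by
  have hN : (0 : ℝ) < n.choose M := by exact_mod_cast Nat.choose_pos hMn
  unfold sampleProb
  rw [Nat.card_eq_fintype_card, Nat.card_eq_fintype_card, Fintype.card_subtype, card_sample,
    le_div_iff₀ hN]
  have h1 : (#{S : Sample n M | induced π S ∈ A} : ℝ) + #{S : Sample n M | induced π S ∉ A} =
      n.choose M := by
    rw [← card_sample (n := n) (M := M), ← Finset.card_univ]
    exact_mod_cast Finset.card_filter_add_card_filter_not (s := univ)
      fun S : Sample n M => induced π S ∈ A
  linarith

theorem kStar_ne_top {P : PermProperty} (α : Equiv.Perm (Fin M)) (h : kStarPerm P α ≠ ⊤) :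
    kStar P M ≠ ⊤ := by
  unfold kStar
  rw [if_pos ⟨α, h⟩]
  have hle : (⨆ α ∈ {α : Equiv.Perm (Fin M) | kStarPerm P α ≠ ⊤}, kStarPerm P α) ≤
      ((∑ α : Equiv.Perm (Fin M), (kStarPerm P α).toNat : ℕ) : ℕ∞) := by
    refine iSup₂_le fun β hβ => ?_
    rw [← ENat.natCast_toNat hβ]
    exact Nat.cast_le.2 (Finset.single_le_sum (f := fun α => (kStarPerm P α).toNat)
      (fun _ _ => Nat.zero_le _) (mem_univ β))
  exact ne_top_of_le_ne_top (ENat.natCast_ne_top _) hle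

theorem kStarPerm_le_kStar {P : PermProperty} (α : Equiv.Perm (Fin M)) (h : kStarPerm P α ≠ ⊤) :
    kStarPerm P α ≤ kStar P M := by
  unfold kStar
  rw [if_pos ⟨α, h⟩]
  exact le_iSup₂_of_le α h le_rfl

theorem exists_no_blowUp_le {P : PermProperty} {α : Equiv.Perm (Fin M)} (h : kStarPerm P α ≠ ⊤)
    {K : ℕ} (hK : kStar P M = K) :
    ∃ k, 0 < k ∧ k ≤ K ∧ ∀ (N : ℕ) (β : Equiv.Perm (Fin N)),
      IsUniformBlowUp k α β → β ∉ P N := by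
  have h1 : kStarPerm P α < ((K + 1 : ℕ) : ℕ∞) :=
    (kStarPerm_le_kStar α h).trans_lt (by rw [hK]; exact Nat.cast_lt.2 (Nat.lt_succ_self K))
  unfold kStarPerm at h1
  simp only [iInf_lt_iff] at h1
  obtain ⟨k, ⟨hk, hno⟩, hlt⟩ := h1
  exact ⟨k, hk, Nat.le_of_lt_succ (Nat.cast_lt.1 hlt), hno⟩

theorem le_mul_of_sizeThreshold_le {P : PermProperty} {ε : ℝ} (hε : 0 < ε) {K : ℕ}
    (hK : kStar P M = K) (h : sizeThreshold P ε M ≤ (n : ℝ≥0∞)) :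
    32 * (M : ℝ) ^ 5 * K ≤ n * ε ^ 3 := by
  unfold sizeThreshold at h
  have h3 : 0 < ε ^ 3 := by positivity
  rw [hK, ENNReal.div_le_iff (by simpa using h3) ENNReal.ofReal_ne_top] at h
  have h' := ENNReal.toReal_mono (ENNReal.mul_ne_top (ENNReal.natCast_ne_top n)
    ENNReal.ofReal_ne_top) h
  simpa [ENNReal.toReal_mul, ENNReal.toReal_pow, ENNReal.toReal_ofReal h3.le] using h'

open Classical in
theorem card_samples_kStarPerm_ne_top_le {P : PermProperty} (hP : Hereditary P) {ε : ℝ}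
    (hε : 0 < ε) (hε2 : ε ≤ 2) (hM : 20000 ≤ ε ^ 2 * M) (hMn : M ≤ n)
    (hn : kStar P M = ⊤ ∨ sizeThreshold P ε M ≤ (n : ℝ≥0∞)) {π : Equiv.Perm (Fin n)}
    (hπ : π ∈ P n) :
    (#{S : Sample n M | kStarPerm P (induced π S) ≠ ⊤} : ℝ) ≤ ε / 6 * n.choose M := by
  by_cases hex : ∃ S : Sample n M, kStarPerm P (induced π S) ≠ ⊤
  · obtain ⟨S, hS⟩ := hex
    have htop := kStar_ne_top _ hS
    obtain ⟨K, hK⟩ := ENat.ne_top_iff_exists.1 htop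
    obtain ⟨k, hk, hkK, -⟩ := exists_no_blowUp_le hS hK.symm
    refine le_trans (Nat.cast_le.2 (Finset.card_le_card fun T hT => ?_))
      (card_samples_no_blowUp_le hP hε hε2 hM hMn (hk.trans_le hkK)
        (le_mul_of_sizeThreshold_le hε hK.symm (hn.resolve_left htop)) hπ)
    simp only [mem_filter, mem_univ, true_and] at hT ⊢
    exact exists_no_blowUp_le hT hK.symm
  · push Not at hex
    simp only [hex, ne_eq, not_true_eq_false, filter_false, card_empty, Nat.cast_zero]
    positivity

open Classical in
theorem card_samples_kStarPerm_eq_top_le {P : PermProperty} (hP : Hereditary P) {ε : ℝ}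
    (hε : 0 < ε) (hε2 : ε ≤ 2) (hM : 20000 ≤ ε ^ 2 * M) (hMn : M ≤ n)
    {π : Equiv.Perm (Fin n)} (hπ : ∀ σ ∈ P n, ε ≤ emd π σ) :
    (#{S : Sample n M | kStarPerm P (induced π S) = ⊤} : ℝ) ≤ ε / 6 * n.choose M := by
  have hM0 : 0 < M := by
    rcases Nat.eq_zero_or_pos M with rfl | h
    · norm_num at hM
    · exact h
  refine le_trans (Nat.cast_le.2 (Finset.card_le_card fun S hS => ?_))
    (card_samples_transportCost_ge hε hε2 hM hMn π)
  simp only [mem_filter, mem_univ, true_and] at hS ⊢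
  obtain ⟨a, ha⟩ := exists_assignment π hM0 S (Nat.succ_pos (n / Nat.sqrt M))
  obtain ⟨σ, hσ, hle⟩ := exists_mem_emd_le hP π S hS a
  have h := (hπ σ hσ).trans hle
  have hn2 : 0 < (n.choose 2 : ℝ) := by
    by_contra! h0
    have : (n.choose 2 : ℝ) = 0 := le_antisymm h0 (Nat.cast_nonneg _)
    rw [this, div_zero] at h
    linarith
  rw [le_div_iff₀ hn2, Nat.cast_choose_two] at h
  linarith

theorem isTwoSidedTester_kStarPerm_eq_top {P : PermProperty} (hP : Hereditary P) {ε : ℝ}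
    (hε : 0 < ε) (hε2 : ε ≤ 2) (hM : 20000 ≤ ε ^ 2 * M)
    (d : ∀ n : ℕ, Equiv.Perm (Fin n) → Equiv.Perm (Fin n) → ℝ)
    (hd : ∀ (n : ℕ) (π σ : Equiv.Perm (Fin n)), d n π σ ≤ emd π σ) :
    IsTwoSidedTester d P ε (max (2 / 3) (1 - ε)) M
      (fun n => kStar P M = ⊤ ∨ sizeThreshold P ε M ≤ (n : ℝ≥0∞)) {α | kStarPerm P α = ⊤} := by
  classical
  intro n hMn hn π
  have hp : max (2 / 3) (1 - ε) ≤ 1 - ε / 6 := max_le (by linarith) (by linarith)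
  refine ⟨fun hπ => hp.trans (le_sampleProb hMn π _ ?_),
    fun hfar => hp.trans (le_sampleProb hMn π _ ?_)⟩
  · simpa using card_samples_kStarPerm_ne_top_le hP hε hε2 hM hMn hn hπ
  · simpa using card_samples_kStarPerm_eq_top_le hP hε hε2 hM hMn fun σ hσ =>
      hfar.trans ((distTo_le d P π hσ).trans (hd n π σ))

theorem isTwoSidedTester_univ {P : PermProperty} {ε : ℝ} (hε : 2 < ε) (L : ℕ → Prop)
    (d : ∀ n : ℕ, Equiv.Perm (Fin n) → Equiv.Perm (Fin n) → ℝ)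
    (hd : ∀ (n : ℕ) (π σ : Equiv.Perm (Fin n)), d n π σ ≤ emd π σ) :
    IsTwoSidedTester d P ε (max (2 / 3) (1 - ε)) M L Set.univ := by
  classical
  intro n hMn _ π
  refine ⟨fun _ => (show max (2 / 3) (1 - ε) ≤ 1 - 0 from max_le (by norm_num) (by linarith)).trans
    (le_sampleProb hMn π _ (by simp)), fun hfar => ?_⟩
  exact absurd hfar (not_le.2 ((distTo_le_two d hd P π).trans_lt hε))

theorem le_sq_mul_sampleSize {ε : ℝ} (hε : 0 < ε) : 20000 ≤ ε ^ 2 * sampleSize ε := by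
  have h := Nat.le_ceil (20000 / ε ^ 2)
  rw [div_le_iff₀ (by positivity), mul_comm] at h
  exact h

end Tester

end PermTesting

theorem theorem5 (P : PermTesting.PermProperty) (hP : PermTesting.Hereditary P)
    (ε : ℝ) (hε : 0 < ε) :
    ∃ A : Set (Equiv.Perm (Fin (PermTesting.sampleSize ε))),
      PermTesting.IsTwoSidedTester (fun _ => PermTesting.planarTau) P ε (max (2 / 3) (1 - ε))
        (PermTesting.sampleSize ε)
        (fun n => PermTesting.kStar P (PermTesting.sampleSize ε) = ⊤ ∨
          PermTesting.sizeThreshold P ε (PermTesting.sampleSize ε) ≤ (n : ENNReal)) A ∧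
      PermTesting.IsTwoSidedTester (fun _ => PermTesting.emd) P ε (max (2 / 3) (1 - ε))
        (PermTesting.sampleSize ε)
        (fun n => PermTesting.kStar P (PermTesting.sampleSize ε) = ⊤ ∨
          PermTesting.sizeThreshold P ε (PermTesting.sampleSize ε) ≤ (n : ENNReal)) A := by
  rcases le_or_gt ε 2 with hε2 | hε2
  · exact ⟨_, PermTesting.isTwoSidedTester_kStarPerm_eq_top hP hε hε2
        (PermTesting.le_sq_mul_sampleSize hε) _ fun _ => PermTesting.planarTau_le_emd,
      PermTesting.isTwoSidedTester_kStarPerm_eq_top hP hε hε2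
        (PermTesting.le_sq_mul_sampleSize hε) _ fun _ _ _ => le_rfl⟩
  · exact ⟨_, PermTesting.isTwoSidedTester_univ hε2 _ _ fun _ => PermTesting.planarTau_le_emd,
      PermTesting.isTwoSidedTester_univ hε2 _ _ fun _ _ _ => le_rfl⟩
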